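/- Let $0<p<1$, $0<q<1$, $\tau>0$, $\kappa>0$ and $\Lambda>0$. For $N_1,N_2,d\ge 1$, two groups with opinions $\mathbf x_i(t),\mathbf y_j(t)\in\mathbb R^d$ ($1\le i\le N_1$, $1\le j\le N_2$, $t\ge 0$) evolve by $$\dot{\mathbf x}_i=\frac1{N_1}\sum_{i'\ne i}\psi^+_{i,i'}(t)(\mathbf x_{i'}-\mathbf x_i)-\frac1{N_2}\sum_j\psi^-_{i,j}(t)(\mathbf y_j-\mathbf x_i),\qquad \dot{\mathbf y}_j=\frac1{N_2}\sum_{j'\ne j}\psi^+_{j,j'}(t)(\mathbf y_{j'}-\mathbf y_j)-\frac1{N_1}\sum_i\psi^-_{i,j}(t)(\mathbf x_i-\mathbf y_j).$$ The coefficients are symmetric ($\psi^+_{i,i'}=\psi^+_{i',i}$, $\psi^+_{j,j'}=\psi^+_{j',j}$), and each is constant in time on every interval $[k\tau,(k+1)\tau)$, $k=0,1,2,\dots$. Their values on these intervals are random variables with values $1$ and $0$: the value $1$ has probability $p$ for each $\psi^+_{i,i'}$ and $\psi^+_{j,j'}$, and probability $q$ for each $\psi^-_{i,j}$. All these variables,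 for different unordered pairs of people and different $k$, are mutually independent. Put $\bar{\mathbf x}=\frac1{N_1}\sum_i\mathbf x_i$, $\bar{\mathbf y}=\frac1{N_2}\sum_j\mathbf y_j$, $\hat{\mathbf x}_i=\mathbf x_i-\bar{\mathbf x}$ and $\hat{\mathbf y}_j=\mathbf y_j-\bar{\mathbf y}$. Then there is a time $T=T(\Lambda,\tau,p,q,\kappa)>0$ such that for every $\varepsilon>0$ there is an $N_0=N_0(\varepsilon,\Lambda,\tau,p,q,\kappa)$ for which the following holds. If $\min\{N_1,N_2\}\ge N_0$ and $\frac1\kappa N_1\le N_2\le\kappa N_1$, then, with probability at least $1-\varepsilon$, for all initial data with $\bar{\mathbf x}(0)\ne\bar{\mathbf y}(0)$ and $$\tilde\lambda(0)=\frac{\max_i|\hat{\mathbf x}_i(0)|^2+\max_j|\hat{\mathbf y}_j(0)|^2}{|\bar{\mathbf x}(0)-\bar{\mathbf y}(0)|^2}\le\Lambda,$$ there is a constant unit vector $\mathbf v\in\mathbb R^d$ such that $$\max_i\big(\mathbf x_i(t)\cdot\mathbf v\big)<\min_j\big(\mathbf y_j(t)\cdot\mathbf v\big)\qquad\text{for all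 }t\ge T.$$ -/

import Mathlib

open MeasureTheory ProbabilityTheory

noncomputable section

/-- The space `ℝ^d` of opinions, with its Euclidean norm. -/
abbrev Opinion (d : ℕ) : Type := EuclideanSpace ℝ (Fin d)

/-- Communication coefficients (at one instant) of two groups of `N₁` and `N₂` people:
`withinX i i'` and `withinY j j'` are the alignment coefficients inside the two groups, and
`between i j` is the anti-alignment coefficient of the `i`-th person of the first group and the
`j`-th person of the second one (in either order). -/
structure Coefficients (N₁ N₂ : ℕ) where
  withinX : Fin N₁ → Fin N₁ → ℝ
  withinY : Fin N₂ → Fin N₂ → ℝ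
  between : Fin N₁ → Fin N₂ → ℝ

/-- The pairs of distinct people who may communicate, each unordered pair being listed once:
two people of the first group, two people of the second group, or one person of each group. -/
abbrev Link (N₁ N₂ : ℕ) : Type :=
  {e : Fin N₁ × Fin N₁ // e.1 < e.2} ⊕ {e : Fin N₂ × Fin N₂ // e.1 < e.2} ⊕ (Fin N₁ × Fin N₂)

/-- The coefficient attached to a pair of people. -/
def Coefficients.value {N₁ N₂ : ℕ} (c : Coefficients N₁ N₂) : Link N₁ N₂ → ℝ
  | .inl e => c.withinX e.1.1 e.1.2
  | .inr (.inl e) => c.withinY e.1.1 e.1.2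
  | .inr (.inr e) => c.between e.1 e.2

/-- The rate of communication of a pair: `p` inside a group, `q` across the groups. -/
def Link.rate {N₁ N₂ : ℕ} (p q : unitInterval) : Link N₁ N₂ → unitInterval
  | .inl _ => p
  | .inr (.inl _) => p
  | .inr (.inr _) => q

/-- `ψ k` is the random table of coefficients in force on the `k`-th time interval. The tables are
symmetric, the coefficients are Bernoulli variables of parameter `p` inside each group and `q`
across the groups, and all of them, for different pairs of people and different time intervals,
are mutually independent. -/
structure IsResampledBernoulli {N₁ N₂ : ℕ} {Ω : Type*} [MeasurableSpace Ω] (P : Measure Ω)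
    (p q : unitInterval) (ψ : ℕ → Ω → Coefficients N₁ N₂) : Prop where
  symmX : ∀ k ω i i', (ψ k ω).withinX i i' = (ψ k ω).withinX i' i
  symmY : ∀ k ω j j', (ψ k ω).withinY j j' = (ψ k ω).withinY j' j
  law : ∀ (k : ℕ) (l : Link N₁ N₂),
    HasLaw (fun ω => (ψ k ω).value l) (bernoulliMeasure (1 : ℝ) 0 (Link.rate p q l)) P
  indep : iIndepFun (fun (kl : ℕ × Link N₁ N₂) (ω : Ω) => (ψ kl.1 ω).value kl.2) P

/-- The piecewise constant function of time equal to `c k` on `[k τ, (k + 1) τ)`, `k = 0, 1, …`. -/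
def piecewiseConstant {α : Type*} (τ : ℝ) (c : ℕ → α) (t : ℝ) : α := c ⌊t / τ⌋₊

/-- The velocity of the `i`-th person of the first group. -/
def velocityX {N₁ N₂ d : ℕ} (c : Coefficients N₁ N₂) (x : Fin N₁ → Opinion d)
    (y : Fin N₂ → Opinion d) (i : Fin N₁) : Opinion d :=
  (1 / (N₁ : ℝ)) • ∑ i' ∈ Finset.univ.erase i, c.withinX i i' • (x i' - x i)
    - (1 / (N₂ : ℝ)) • ∑ j, c.between i j • (y j - x i)

/-- The velocity of the `j`-th person of the second group. -/
def velocityY {N₁ N₂ d : ℕ} (c : Coefficients N₁ N₂) (x : Fin N₁ → Opinion d)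
    (y : Fin N₂ → Opinion d) (j : Fin N₂) : Opinion d :=
  (1 / (N₂ : ℝ)) • ∑ j' ∈ Finset.univ.erase j, c.withinY j j' • (y j' - y j)
    - (1 / (N₁ : ℝ)) • ∑ i, c.between i j • (x i - y j)

/-- `x`, `y` solve the two-group system on `[0, ∞)` with time-dependent coefficients `c`: they are
continuous and satisfy the equations at every time `t ≥ 0`, with the right derivative (the
coefficients are right-continuous step functions, so there are corners at their jumps). -/
structure IsSolution {N₁ N₂ d : ℕ} (c : ℝ → Coefficients N₁ N₂) (x : ℝ → Fin N₁ → Opinion d)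
    (y : ℝ → Fin N₂ → Opinion d) : Prop where
  contX : ∀ i, ContinuousOn (fun t => x t i) (Set.Ici 0)
  contY : ∀ j, ContinuousOn (fun t => y t j) (Set.Ici 0)
  derivX : ∀ i, ∀ t, 0 ≤ t →
    HasDerivWithinAt (fun s => x s i) (velocityX (c t) (x t) (y t) i) (Set.Ici t) t
  derivY : ∀ j, ∀ t, 0 ≤ t →
    HasDerivWithinAt (fun s => y s j) (velocityY (c t) (x t) (y t) j) (Set.Ici t) t

/-- The mean location of a group. -/
def meanLocation {N d : ℕ} (x : Fin N → Opinion d) : Opinion d := (1 / (N : ℝ)) • ∑ i, x i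

/-- The deviation of the `i`-th person from the mean location of the group. -/
def deviation {N d : ℕ} (x : Fin N → Opinion d) (i : Fin N) : Opinion d := x i - meanLocation x

/-- The ratio of the maximal squared deviations inside the groups to the squared distance of the
mean locations (meaningful only if the means differ). -/
def deviationRatio {N₁ N₂ d : ℕ} (x : Fin N₁ → Opinion d) (y : Fin N₂ → Opinion d) : ℝ :=
  ((⨆ i, ‖deviation x i‖ ^ 2) + ⨆ j, ‖deviation y j‖ ^ 2) / ‖meanLocation x - meanLocation y‖ ^ 2

/-- The direction `v` separates the two groups: `max_i x_i ⬝ v < min_j y_j ⬝ v`. -/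
def IsSeparatedBy {N₁ N₂ d : ℕ} (v : Opinion d) (x : Fin N₁ → Opinion d)
    (y : Fin N₂ → Opinion d) : Prop :=
  (⨆ i, inner ℝ (x i) v) < ⨅ j, inner ℝ (y j) v

end

/-! ### Scalar two-group flows and quasirandom coefficients. -/

section TwoGroupFlow

open Finset
open scoped BigOperators

variable {ι κ : Type*} [Fintype ι] [Fintype κ]

/-! Project onto the line through the two initial means, scaled so that they sit at 0 and 1; every
deviation is then at most `√Λ`. If all repulsion coefficients were equal to `q`, each mean would be
driven away at `q` times the gap, so the gap would grow like `e^{2qt}`. Deviations are only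
amplified at rate `q`: symmetric alignment preserves the means and dissipates the variance, so the
root mean square deviation grows at most like `e^{qt}`, and under this forcing a single deviation is
at most `e^{qt}` times an affine function of `t`. Hence the gap wins by a time `T` depending on `Λ`
and `q` (`exists_affine_lt_exp_mul`).

Random coefficients act like `q` up to an error `δ`: the cut norm handles the gap and the variance,
row and column averages handle single people. Grönwall bounds all opinions on `[0, T]` independently
of the group sizes, so a fixed small `δ` suffices (`lt_of_isQuasirandom`). Only about `T / τ` tables
are in force before `T`, and Hoeffding with union bounds makes them all quasirandom
(`measureReal_not_isQuasirandom_le`). This event does not involve the initial data, whence the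
uniformity in them. After `T` no randomness is needed: separated half-lines are invariant for
arbitrary coefficients in `[0, 1]` (`le_and_le_of_le`). -/

/-- Velocity of the scalar opinion `x i`, aligned with the group `x` through `a` and repelled by
the group `y` through `c`. -/
noncomputable def groupRate (a : ι → ι → ℝ) (c : ι → κ → ℝ) (x : ι → ℝ) (y : κ → ℝ) (i : ι) : ℝ :=
  (𝔼 i', a i i' * (x i' - x i)) - 𝔼 j, c i j * (y j - x i)

/-- The coefficients are close to the constant `q` in row averages, column averages and cut norm. -/
structure IsQuasirandom (δ q : ℝ) (c : ι → κ → ℝ) : Prop where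
  row : ∀ i, |𝔼 j, (c i j - q)| ≤ δ
  col : ∀ j, |𝔼 i, (c i j - q)| ≤ δ
  cut : ∀ (f : ι → ℝ) (g : κ → ℝ), (∀ i, |f i| ≤ 1) → (∀ j, |g j| ≤ 1) →
    |𝔼 i, 𝔼 j, (c i j - q) * (f i * g j)| ≤ δ

/-- A scalar two-group flow with symmetric coefficients in `[0, 1]`. -/
structure IsTwoGroupFlow (a : ℝ → ι → ι → ℝ) (b : ℝ → κ → κ → ℝ) (c : ℝ → ι → κ → ℝ)
    (x : ℝ → ι → ℝ) (y : ℝ → κ → ℝ) : Prop where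
  symmX : ∀ t i i', a t i i' = a t i' i
  symmY : ∀ t j j', b t j j' = b t j' j
  memX : ∀ t i i', a t i i' ∈ Set.Icc (0 : ℝ) 1
  memY : ∀ t j j', b t j j' ∈ Set.Icc (0 : ℝ) 1
  memXY : ∀ t i j, c t i j ∈ Set.Icc (0 : ℝ) 1
  contX : ∀ i, ContinuousOn (fun t => x t i) (Set.Ici 0)
  contY : ∀ j, ContinuousOn (fun t => y t j) (Set.Ici 0)
  derivX : ∀ i, ∀ t, 0 ≤ t →
    HasDerivWithinAt (fun s => x s i) (groupRate (a t) (c t) (x t) (y t) i) (Set.Ici t) t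
  derivY : ∀ j, ∀ t, 0 ≤ t →
    HasDerivWithinAt (fun s => y s j) (groupRate (b t) (fun j i => c t i j) (y t) (x t) j)
      (Set.Ici t) t

lemma IsQuasirandom.swap {δ q : ℝ} {c : ι → κ → ℝ} (h : IsQuasirandom δ q c) :
    IsQuasirandom δ q (fun j i => c i j) where
  row := h.col
  col := h.row
  cut f g hf hg := by
    have := h.cut g f hg hf
    rw [expect_comm] at this
    simpa only [mul_comm (f _) (g _)] using this

lemma IsTwoGroupFlow.swap {a : ℝ → ι → ι → ℝ} {b : ℝ → κ → κ → ℝ} {c : ℝ → ι → κ → ℝ}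
    {x : ℝ → ι → ℝ} {y : ℝ → κ → ℝ} (h : IsTwoGroupFlow a b c x y) :
    IsTwoGroupFlow b a (fun t j i => c t i j) y x where
  symmX := h.symmY
  symmY := h.symmX
  memX := h.memY
  memY := h.memX
  memXY t j i := h.memXY t i j
  contX := h.contY
  contY := h.contX
  derivX := h.derivY
  derivY := h.derivX

lemma abs_expect_le_of_forall_abs_le {f : ι → ℝ} {B : ℝ} (hB : 0 ≤ B) (h : ∀ i, |f i| ≤ B) :
    |𝔼 i, f i| ≤ B := by
  rcases isEmpty_or_nonempty ι with hι | hι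
  · simpa using hB
  · exact (abs_expect_le _ _).trans (expect_le univ_nonempty fun i _ => h i)

lemma IsQuasirandom.abs_expect_le_mul {δ q A B : ℝ} {c : ι → κ → ℝ} (h : IsQuasirandom δ q c)
    (hA : 0 < A) (hB : 0 < B) {f : ι → ℝ} {g : κ → ℝ} (hf : ∀ i, |f i| ≤ A)
    (hg : ∀ j, |g j| ≤ B) : |𝔼 i, 𝔼 j, (c i j - q) * (f i * g j)| ≤ δ * (A * B) := by
  have key := h.cut (fun i => f i / A) (fun j => g j / B)
    (fun i => by rw [abs_div, abs_of_pos hA]; exact (div_le_one hA).2 (hf i))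
    (fun j => by rw [abs_div, abs_of_pos hB]; exact (div_le_one hB).2 (hg j))
  have e : 𝔼 i, 𝔼 j, (c i j - q) * (f i * g j)
      = (𝔼 i, 𝔼 j, (c i j - q) * (f i / A * (g j / B))) * (A * B) := by
    simp only [expect_mul]
    refine expect_congr rfl fun i _ => expect_congr rfl fun j _ => ?_
    field_simp
  rw [e, abs_mul, abs_of_pos (mul_pos hA hB)]
  gcongr

/-- Summation by parts. With `u = 1` it shows that alignment preserves the mean; with `u = x` that
it dissipates the variance. -/
lemma expect_alignment {a : ι → ι → ℝ} (ha : ∀ i i', a i i' = a i' i) (u x : ι → ℝ) :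
    𝔼 i, u i * 𝔼 i', a i i' * (x i' - x i)
      = -(1 / 2) * 𝔼 i, 𝔼 i', a i i' * ((u i - u i') * (x i - x i')) := by
  have h1 : 𝔼 i, u i * 𝔼 i', a i i' * (x i' - x i)
      = 𝔼 i, 𝔼 i', u i' * (a i i' * (x i - x i')) := by
    simp only [mul_expect]
    rw [expect_comm]
    exact expect_congr rfl fun i _ => expect_congr rfl fun i' _ => by rw [ha]
  have h2 : 𝔼 i, 𝔼 i', a i i' * ((u i - u i') * (x i - x i'))
      = -(𝔼 i, u i * 𝔼 i', a i i' * (x i' - x i)) - 𝔼 i, 𝔼 i', u i' * (a i i' * (x i - x i')) := by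
    simp only [mul_expect, ← expect_neg_distrib, ← expect_sub_distrib]
    exact expect_congr rfl fun i _ => expect_congr rfl fun i' _ => by ring
  rw [h2, ← h1]; ring

lemma expect_groupRate {a : ι → ι → ℝ} (ha : ∀ i i', a i i' = a i' i) (c : ι → κ → ℝ)
    (x : ι → ℝ) (y : κ → ℝ) :
    𝔼 i, groupRate a c x y i = -𝔼 i, 𝔼 j, c i j * (y j - x i) := by
  have h := expect_alignment ha (fun _ => 1) x
  simp only [one_mul, sub_self, zero_mul, mul_zero, expect_const_zero] at h
  simp only [groupRate, expect_sub_distrib, h, zero_sub]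

lemma expect_sub_expect [Nonempty ι] (x : ι → ℝ) : 𝔼 i, (x i - 𝔼 i', x i') = 0 := by
  rw [expect_sub_distrib, Fintype.expect_const, sub_self]

section Static

variable [Nonempty κ] {δ q M W : ℝ} {c : ι → κ → ℝ} {u : ι → ℝ} {z : κ → ℝ}

/-- Replacing `c` by `q` turns the flux into exactly `q * W`, as `u` and `z` average to zero; each
of the three summands then costs one cut-norm error. -/
lemma IsQuasirandom.abs_flux_sub_le [Nonempty ι] (h : IsQuasirandom δ q c) (hM : 0 < M)
    (hW : |W| ≤ M) (hu : ∀ i, |u i| ≤ M) (hz : ∀ j, |z j| ≤ M) (hu0 : 𝔼 i, u i = 0)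
    (hz0 : 𝔼 j, z j = 0) : |(𝔼 i, 𝔼 j, c i j * (W + z j - u i)) - q * W| ≤ 3 * δ * M := by
  have h1 := h.abs_expect_le_mul (f := fun _ => W) (g := fun _ => 1) hM one_pos (fun _ => hW)
    (fun _ => by simp)
  have h2 := h.abs_expect_le_mul (f := fun _ => 1) (g := z) one_pos hM (fun _ => by simp) hz
  have h3 := h.abs_expect_le_mul (f := u) (g := fun _ => 1) hM one_pos hu (fun _ => by simp)
  have e : 𝔼 i, 𝔼 j, c i j * (W + z j - u i) = (𝔼 i, 𝔼 j, (c i j - q) * (W * 1))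
      + (𝔼 i, 𝔼 j, (c i j - q) * (1 * z j)) - (𝔼 i, 𝔼 j, (c i j - q) * (u i * 1))
      + q * (W + (𝔼 j, z j) - 𝔼 i, u i) := by
    have e1 : W + (𝔼 j, z j) - 𝔼 i, u i = 𝔼 i, 𝔼 j, (W + z j - u i) := by
      simp [expect_add_distrib, expect_sub_distrib]
    rw [e1]
    simp only [mul_expect, ← expect_sub_distrib, ← expect_add_distrib]
    exact expect_congr rfl fun i _ => expect_congr rfl fun j _ => by ring
  rw [e, hu0, hz0]
  simp only [abs_le] at *
  constructor <;> linarith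

/-- Alignment contributes a nonpositive term. In the repulsion with `c` replaced by `q`, the cross
terms vanish by the zero averages and only `q * 𝔼 u²` survives. -/
lemma IsQuasirandom.energy_rate_le {a : ι → ι → ℝ} (h : IsQuasirandom δ q c)
    (ha : ∀ i i', a i i' = a i' i) (ha0 : ∀ i i', 0 ≤ a i i') (hM : 0 < M)
    (hW : |W| ≤ M) (hu : ∀ i, |u i| ≤ M) (hz : ∀ j, |z j| ≤ M) (hu0 : 𝔼 i, u i = 0)
    (hz0 : 𝔼 j, z j = 0) :
    𝔼 i, u i * ((𝔼 i', a i i' * (u i' - u i)) - 𝔼 j, c i j * (W + z j - u i))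
      ≤ q * (𝔼 i, u i ^ 2) + 3 * δ * M ^ 2 := by
  have h1 := h.abs_expect_le_mul (f := fun i => u i ^ 2) (g := fun _ => 1) (pow_pos hM 2) one_pos
    (fun i => by rw [abs_pow]; exact pow_le_pow_left₀ (abs_nonneg _) (hu i) 2) (fun _ => by simp)
  have h2 := h.abs_expect_le_mul (f := u) (g := z) hM hM hu hz
  have h3 := h.abs_expect_le_mul (f := u) (g := fun _ => W) hM hM hu (fun _ => hW)
  have e : 𝔼 i, u i * (𝔼 j, c i j * (W + z j - u i))
      = (𝔼 i, 𝔼 j, (c i j - q) * (u i * z j)) + (𝔼 i, 𝔼 j, (c i j - q) * (u i * W))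
        - (𝔼 i, 𝔼 j, (c i j - q) * (u i ^ 2 * 1)) + q * ((𝔼 i, u i) * (𝔼 j, z j)
          + (𝔼 i, u i) * W - 𝔼 i, u i ^ 2) := by
    have e1 : (𝔼 i, u i) * (𝔼 j, z j) + (𝔼 i, u i) * W - 𝔼 i, u i ^ 2
        = 𝔼 i, 𝔼 j, (u i * z j + u i * W - u i ^ 2) := by
      simp [expect_add_distrib, expect_sub_distrib, expect_mul, mul_expect]
      exact expect_comm ..
    rw [e1]
    simp only [mul_expect, ← expect_sub_distrib, ← expect_add_distrib]
    exact expect_congr rfl fun i _ => expect_congr rfl fun j _ => by ring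
  have h4 : 0 ≤ 𝔼 i, 𝔼 i', a i i' * ((u i - u i') * (u i - u i')) :=
    expect_nonneg fun i _ => expect_nonneg fun i' _ => mul_nonneg (ha0 i i') (mul_self_nonneg _)
  have e2 : 𝔼 i, u i * ((𝔼 i', a i i' * (u i' - u i)) - 𝔼 j, c i j * (W + z j - u i))
      = (𝔼 i, u i * 𝔼 i', a i i' * (u i' - u i))
        - 𝔼 i, u i * 𝔼 j, c i j * (W + z j - u i) := by
    rw [← expect_sub_distrib]
    exact expect_congr rfl fun i _ => mul_sub _ _ _
  rw [e2, expect_alignment ha, e, hu0, hz0]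
  simp only [abs_le] at h1 h2 h3
  nlinarith [h1.1, h2.2, h3.2, h1.2, h2.1, h3.1]

end Static

lemma expect_abs_le_of_expect_sq_le {u : ι → ℝ} {G : ℝ} (hG : 0 ≤ G) (h : 𝔼 i, u i ^ 2 ≤ G ^ 2) :
    𝔼 i, |u i| ≤ G := by
  have := expect_mul_sq_le_sq_mul_sq (univ : Finset ι) (fun i => |u i|) (fun _ => (1 : ℝ))
  refine le_of_sq_le_sq ?_ hG
  rcases isEmpty_or_nonempty ι with hι | hι
  · simpa using sq_nonneg G
  · simp only [mul_one, sq_abs, one_pow, Fintype.expect_const] at this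
    exact this.trans h

end TwoGroupFlow

/-! ### A priori growth and pointwise rates. -/

section TwoGroupDynamics

open Finset
open scoped BigOperators

variable {ι κ : Type*} [Fintype ι] [Fintype κ]

lemma hasDerivWithinAt_expect {f : ℝ → ι → ℝ} {f' : ι → ℝ} {s : Set ℝ} {t : ℝ}
    (h : ∀ i, HasDerivWithinAt (fun r => f r i) (f' i) s t) :
    HasDerivWithinAt (fun r => 𝔼 i, f r i) (𝔼 i, f' i) s t := by
  simp only [Fintype.expect_eq_sum_div_card]
  exact (HasDerivWithinAt.fun_sum fun i _ => h i).div_const _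

lemma continuousOn_expect {f : ℝ → ι → ℝ} {s : Set ℝ}
    (h : ∀ i, ContinuousOn (fun r => f r i) s) : ContinuousOn (fun r => 𝔼 i, f r i) s := by
  simp only [Fintype.expect_eq_sum_div_card]
  exact (continuousOn_finsetSum _ fun i _ => h i).div_const _

lemma groupRate_neg (a : ι → ι → ℝ) (c : ι → κ → ℝ) (x : ι → ℝ) (y : κ → ℝ) (i : ι) :
    groupRate a c (fun i => -x i) (fun j => -y j) i = -groupRate a c x y i := by
  simp only [groupRate, neg_sub_neg, neg_sub]
  simp only [← expect_neg_distrib, sub_eq_add_neg, neg_add, neg_neg, ← mul_neg, add_comm]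

lemma abs_groupRate_le {a : ι → ι → ℝ} {c : ι → κ → ℝ} {x : ι → ℝ} {y : κ → ℝ} {R : ℝ}
    (ha : ∀ i i', a i i' ∈ Set.Icc (0 : ℝ) 1) (hc : ∀ i j, c i j ∈ Set.Icc (0 : ℝ) 1)
    (hR : 0 ≤ R) (hx : ∀ i, |x i| ≤ R) (hy : ∀ j, |y j| ≤ R) (i : ι) :
    |groupRate a c x y i| ≤ 4 * R := by
  have aux : ∀ s v w : ℝ, s ∈ Set.Icc (0 : ℝ) 1 → |v| ≤ R → |w| ≤ R → |s * (v - w)| ≤ 2 * R := by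
    intro s v w hs hv hw
    rw [abs_mul, abs_of_nonneg hs.1]
    calc s * |v - w| ≤ 1 * |v - w| := by gcongr; exact hs.2
      _ ≤ |v| + |w| := by rw [one_mul]; exact abs_sub _ _
      _ ≤ 2 * R := by linarith
  have h1 := abs_expect_le_of_forall_abs_le (by positivity)
    fun i' => aux (a i i') (x i') (x i) (ha i i') (hx i') (hx i)
  have h2 := abs_expect_le_of_forall_abs_le (by positivity)
    fun j => aux (c i j) (y j) (x i) (hc i j) (hy j) (hx i)
  calc |groupRate a c x y i| ≤ _ := abs_sub _ _
    _ ≤ 4 * R := by linarith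

namespace IsTwoGroupFlow

variable {a : ℝ → ι → ι → ℝ} {b : ℝ → κ → κ → ℝ} {c : ℝ → ι → κ → ℝ}
    {x : ℝ → ι → ℝ} {y : ℝ → κ → ℝ}

lemma neg (h : IsTwoGroupFlow a b c x y) :
    IsTwoGroupFlow a b c (fun t i => -x t i) (fun t j => -y t j) where
  symmX := h.symmX
  symmY := h.symmY
  memX := h.memX
  memY := h.memY
  memXY := h.memXY
  contX i := (h.contX i).neg
  contY j := (h.contY j).neg
  derivX i t ht := by
    rw [groupRate_neg]
    exact (h.derivX i t ht).fun_neg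
  derivY j t ht := by
    rw [groupRate_neg]
    exact (h.derivY j t ht).fun_neg

/-- A crude bound, but independent of the group sizes: `δ` can be chosen after it. -/
lemma abs_le_mul_exp (h : IsTwoGroupFlow a b c x y) {R : ℝ} (hR : 0 ≤ R)
    (hx : ∀ i, |x 0 i| ≤ R) (hy : ∀ j, |y 0 j| ≤ R) {t : ℝ} (ht : 0 ≤ t) :
    (∀ i, |x t i| ≤ R * Real.exp (4 * t)) ∧ ∀ j, |y t j| ≤ R * Real.exp (4 * t) := by
  have key := norm_le_gronwallBound_of_norm_deriv_right_le (E := (ι → ℝ) × (κ → ℝ))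
    (f := fun t => (x t, y t)) (δ := R) (K := 4) (ε := 0) (a := 0) (b := t)
    (f' := fun t => (groupRate (a t) (c t) (x t) (y t),
      groupRate (b t) (fun j i => c t i j) (y t) (x t)))
    ((continuousOn_pi.2 fun i => (h.contX i).mono Set.Icc_subset_Ici_self).prodMk
      (continuousOn_pi.2 fun j => (h.contY j).mono Set.Icc_subset_Ici_self))
    (fun s hs => (hasDerivWithinAt_pi.2 fun i => h.derivX i s hs.1).prodMk
      (hasDerivWithinAt_pi.2 fun j => h.derivY j s hs.1))
    (norm_prod_le_iff.2 ⟨(pi_norm_le_iff_of_nonneg hR).2 hx, (pi_norm_le_iff_of_nonneg hR).2 hy⟩)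
    (fun s _ => by
      have hx' : ∀ i, |x s i| ≤ ‖(x s, y s)‖ := fun i =>
        (norm_le_pi_norm (x s) i).trans (norm_fst_le (x s, y s))
      have hy' : ∀ j, |y s j| ≤ ‖(x s, y s)‖ := fun j =>
        (norm_le_pi_norm (y s) j).trans (norm_snd_le (x s, y s))
      rw [add_zero, norm_prod_le_iff]
      exact ⟨(pi_norm_le_iff_of_nonneg (by positivity)).2 fun i =>
          abs_groupRate_le (h.memX s) (h.memXY s) (norm_nonneg _) hx' hy' i,
        (pi_norm_le_iff_of_nonneg (by positivity)).2 fun j =>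
          abs_groupRate_le (h.memY s) (fun j i => h.memXY s i j) (norm_nonneg _) hy' hx' j⟩)
    t ⟨ht, le_rfl⟩
  rw [gronwallBound_ε0, sub_zero] at key
  exact ⟨fun i => ((norm_le_pi_norm (x t) i).trans (norm_fst_le (x t, y t))).trans key,
    fun j => ((norm_le_pi_norm (y t) j).trans (norm_snd_le (x t, y t))).trans key⟩

end IsTwoGroupFlow

lemma groupRate_eq_of_decomposition (a : ι → ι → ℝ) (c : ι → κ → ℝ) (x : ι → ℝ) (y : κ → ℝ)
    (mx my : ℝ) (i : ι) : groupRate a c x y i = (𝔼 i', a i i' * ((x i' - mx) - (x i - mx)))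
      - 𝔼 j, c i j * ((my - mx) + (y j - my) - (x i - mx)) := by
  simp only [groupRate, sub_sub_sub_cancel_right]
  congr 1
  exact expect_congr rfl fun j _ => by ring

/-- The drift `q * W` felt by one person cancels against the drift of the mean. The error is `2δM`
from the row average and `3δM` from the flux. -/
lemma IsQuasirandom.deviation_rate_le [Nonempty ι] [Nonempty κ] {δ q M W : ℝ} {a : ι → ι → ℝ}
    {c : ι → κ → ℝ} {u : ι → ℝ} {z : κ → ℝ} (h : IsQuasirandom δ q c)
    (ha : ∀ i i', a i i' ∈ Set.Icc (0 : ℝ) 1) (hc : ∀ i j, c i j ∈ Set.Icc (0 : ℝ) 1)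
    (hδ : 0 ≤ δ) (hM : 0 < M) (hW : |W| ≤ M) (hu : ∀ i, |u i| ≤ M) (hz : ∀ j, |z j| ≤ M)
    (hu0 : 𝔼 i, u i = 0) (hz0 : 𝔼 j, z j = 0) (i : ι) (hi : 0 ≤ u i) :
    (𝔼 i', a i i' * (u i' - u i)) - (𝔼 j, c i j * (W + z j - u i))
        + 𝔼 i, 𝔼 j, c i j * (W + z j - u i)
      ≤ q * u i + (𝔼 i, |u i|) + (𝔼 j, |z j|) + 5 * δ * M := by
  have h1 := h.abs_flux_sub_le hM hW hu hz hu0 hz0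
  have h2 := h.row i
  -- Since `u i ≥ 0`, the pull towards the own mean is discarded and `a ≤ 1` bounds the rest.
  have h3 : 𝔼 i', a i i' * (u i' - u i) ≤ 𝔼 i', |u i'| := expect_le_expect fun i' _ => by
    have := ha i i'
    nlinarith [this.1, this.2, abs_nonneg (u i'), le_abs_self (u i')]
  have h4 : -(𝔼 j, c i j * z j) ≤ 𝔼 j, |z j| := by
    rw [← expect_neg_distrib]
    refine expect_le_expect fun j _ => ?_
    have := hc i j
    nlinarith [this.1, this.2, abs_nonneg (z j), neg_abs_le (z j)]
  have h5 : 𝔼 j, c i j * (W + z j - u i)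
      = ((𝔼 j, (c i j - q)) + q) * (W - u i) + 𝔼 j, c i j * z j := by
    rw [expect_sub_distrib, Fintype.expect_const, sub_add_cancel, expect_mul, ← expect_add_distrib]
    exact expect_congr rfl fun j _ => by ring
  rw [h5]
  have h6 : |(𝔼 j, (c i j - q)) * (W - u i)| ≤ δ * (2 * M) := by
    rw [abs_mul]
    gcongr
    calc |W - u i| ≤ |W| + |u i| := abs_sub _ _
      _ ≤ 2 * M := by linarith [hu i]
  have h7 := (abs_le.1 h1).2
  have h8 := (abs_le.1 h6).1
  nlinarith

end TwoGroupDynamics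

/-! ### The gap between the means outgrows the deviations. -/

section Separation

open Finset
open scoped BigOperators

variable {ι κ : Type*} [Fintype ι] [Fintype κ]

/-- The barrier solves `B' = r B + C e^{rt}`; the resonant forcing produces the linear factor. The
differential inequality is needed only where `f` touches the barrier. -/
lemma le_exp_mul_affine_of_deriv_right_lt {f f' : ℝ → ℝ} {A C r T : ℝ}
    (hf : ContinuousOn f (Set.Icc 0 T))
    (hf' : ∀ t ∈ Set.Ico 0 T, HasDerivWithinAt f (f' t) (Set.Ici t) t) (h0 : f 0 ≤ A)
    (bound : ∀ t ∈ Set.Ico 0 T, f t = Real.exp (r * t) * (A + C * t) →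
      f' t < r * f t + C * Real.exp (r * t)) {t : ℝ} (ht : t ∈ Set.Icc 0 T) :
    f t ≤ Real.exp (r * t) * (A + C * t) := by
  have hB : ∀ s, HasDerivAt (fun s => Real.exp (r * s) * (A + C * s))
      (r * (Real.exp (r * s) * (A + C * s)) + C * Real.exp (r * s)) s := by
    intro s
    have h1 : HasDerivAt (fun s => Real.exp (r * s)) (Real.exp (r * s) * (r * 1)) s :=
      ((hasDerivAt_id s).const_mul r).exp
    have h2 : HasDerivAt (fun s => A + C * s) (C * 1) s :=
      ((hasDerivAt_id s).const_mul C).const_add A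
    exact (h1.fun_mul h2).congr_deriv (by ring)
  refine image_le_of_deriv_right_lt_deriv_boundary hf hf' (by simpa using h0) hB ?_ ht
  intro s hs he
  rw [← he]
  exact bound s hs he

lemma one_le_exp_mul {r t : ℝ} (hr : 0 ≤ r) (ht : 0 ≤ t) : 1 ≤ Real.exp (r * t) :=
  Real.one_le_exp (mul_nonneg hr ht)

namespace IsTwoGroupFlow

variable {a : ℝ → ι → ι → ℝ} {b : ℝ → κ → κ → ℝ} {c : ℝ → ι → κ → ℝ}
    {x : ℝ → ι → ℝ} {y : ℝ → κ → ℝ}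

lemma continuousOn_deviation (h : IsTwoGroupFlow a b c x y) (i : ι) :
    ContinuousOn (fun s => x s i - 𝔼 i', x s i') (Set.Ici 0) :=
  (h.contX i).sub (continuousOn_expect h.contX)

lemma hasDerivWithinAt_deviation (h : IsTwoGroupFlow a b c x y) (i : ι) {t : ℝ} (ht : 0 ≤ t) :
    HasDerivWithinAt (fun s => x s i - 𝔼 i', x s i') (groupRate (a t) (c t) (x t) (y t) i
      - 𝔼 i', groupRate (a t) (c t) (x t) (y t) i') (Set.Ici t) t :=
  (h.derivX i t ht).fun_sub (hasDerivWithinAt_expect fun i' => h.derivX i' t ht)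

lemma hasDerivWithinAt_energy [Nonempty ι] (h : IsTwoGroupFlow a b c x y) {t : ℝ} (ht : 0 ≤ t) :
    HasDerivWithinAt (fun s => 𝔼 i, (x s i - 𝔼 i', x s i') ^ 2)
      (2 * 𝔼 i, (x t i - 𝔼 i', x t i') * groupRate (a t) (c t) (x t) (y t) i) (Set.Ici t) t := by
  refine (hasDerivWithinAt_expect fun i => (h.hasDerivWithinAt_deviation i ht).fun_pow 2).congr_deriv
    ?_
  have e : ∀ i, ((2 : ℕ) : ℝ) * (x t i - 𝔼 i', x t i') ^ (2 - 1)
        * (groupRate (a t) (c t) (x t) (y t) i - 𝔼 i', groupRate (a t) (c t) (x t) (y t) i')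
      = 2 * ((x t i - 𝔼 i', x t i') * groupRate (a t) (c t) (x t) (y t) i)
        - (x t i - 𝔼 i', x t i') * (2 * 𝔼 i', groupRate (a t) (c t) (x t) (y t) i') := by
    intro i; norm_num; ring
  simp only [e]
  rw [expect_sub_distrib, ← expect_mul, expect_sub_expect, zero_mul, sub_zero, mul_expect]

lemma expect_groupRate_eq (h : IsTwoGroupFlow a b c x y) (t : ℝ) :
    𝔼 i, groupRate (a t) (c t) (x t) (y t) i = -𝔼 i, 𝔼 j, c t i j *
      (((𝔼 j', y t j') - 𝔼 i', x t i') + (y t j - 𝔼 j', y t j') - (x t i - 𝔼 i', x t i')) := by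
  rw [expect_groupRate (h.symmX t)]
  congr 1
  exact expect_congr rfl fun i _ => expect_congr rfl fun j _ => by ring

variable {δ q T M : ℝ}

section Bounds

variable [Nonempty ι] [Nonempty κ] (h : IsTwoGroupFlow a b c x y)
  (hc : ∀ t ∈ Set.Ico 0 T, IsQuasirandom δ q (c t)) (hM : 0 < M)
  (hW : ∀ t ∈ Set.Ico 0 T, |(𝔼 j, y t j) - 𝔼 i, x t i| ≤ M)
  (hu : ∀ t ∈ Set.Ico 0 T, ∀ i, |x t i - 𝔼 i', x t i'| ≤ M)
  (hz : ∀ t ∈ Set.Ico 0 T, ∀ j, |y t j - 𝔼 j', y t j'| ≤ M)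
include h hc hM hW hu hz

lemma energy_le (hq : 0 ≤ q) {A C : ℝ} (hC : 12 * δ * M ^ 2 < C) (hC0 : 0 ≤ C)
    (h0 : (𝔼 i, (x 0 i - 𝔼 i', x 0 i') ^ 2) + 𝔼 j, (y 0 j - 𝔼 j', y 0 j') ^ 2 ≤ A)
    {t : ℝ} (ht : t ∈ Set.Icc 0 T) :
    (𝔼 i, (x t i - 𝔼 i', x t i') ^ 2) + 𝔼 j, (y t j - 𝔼 j', y t j') ^ 2
      ≤ Real.exp (2 * q * t) * (A + C * t) := by
  have hcont : ContinuousOn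
      (fun t => (𝔼 i, (x t i - 𝔼 i', x t i') ^ 2) + 𝔼 j, (y t j - 𝔼 j', y t j') ^ 2)
      (Set.Ici 0) :=
    (continuousOn_expect fun i => (h.continuousOn_deviation i).pow 2).add
      (continuousOn_expect fun j => (h.swap.continuousOn_deviation j).pow 2)
  have hderiv := fun s (hs : s ∈ Set.Ico 0 T) =>
    (h.hasDerivWithinAt_energy hs.1).fun_add (h.swap.hasDerivWithinAt_energy hs.1)
  refine le_exp_mul_affine_of_deriv_right_lt (hcont.mono Set.Icc_subset_Ici_self) hderiv
    h0 (fun s hs _ => ?_) ht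
  have h1 := (hc s hs).energy_rate_le (h.symmX s) (fun i i' => (h.memX s i i').1) hM (hW s hs)
    (hu s hs) (hz s hs) (expect_sub_expect _) (expect_sub_expect _)
  have h2 := (hc s hs).swap.energy_rate_le (h.symmY s) (fun j j' => (h.memY s j j').1) hM
    ((abs_sub_comm _ _).trans_le (hW s hs))
    (hz s hs) (hu s hs) (expect_sub_expect _) (expect_sub_expect _)
  simp only [← groupRate_eq_of_decomposition] at h1
  simp only [← groupRate_eq_of_decomposition (b s) (fun j i => c s i j) (y s) (x s)] at h2
  have h3 : C ≤ C * Real.exp (2 * q * s) :=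
    le_mul_of_one_le_right hC0 (one_le_exp_mul (by positivity) hs.1)
  linarith

lemma exp_mul_le_expect_sub (hq : 0 ≤ q) {C : ℝ} (hC : 6 * δ * M < C) (hC0 : 0 ≤ C)
    (h0 : (𝔼 j, y 0 j) - 𝔼 i, x 0 i = 1) {t : ℝ} (ht : t ∈ Set.Icc 0 T) :
    Real.exp (2 * q * t) * (1 - C * t) ≤ (𝔼 j, y t j) - 𝔼 i, x t i := by
  -- The barrier gives upper bounds, so it is applied to minus the gap, which starts at `-1`.
  have key := le_exp_mul_affine_of_deriv_right_lt
    (f := fun t => (𝔼 i, x t i) - 𝔼 j, y t j) (A := -1) (C := C) (r := 2 * q)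
    (((continuousOn_expect h.contX).sub (continuousOn_expect h.contY)).mono
        Set.Icc_subset_Ici_self)
    (fun s hs => (hasDerivWithinAt_expect fun i => h.derivX i s hs.1).fun_sub
      (hasDerivWithinAt_expect fun j => h.derivY j s hs.1))
    (by linarith) (fun s hs _ => ?_) ht
  · linarith
  have h1 := (hc s hs).abs_flux_sub_le hM (hW s hs)
    (hu s hs) (hz s hs) (expect_sub_expect _) (expect_sub_expect _)
  have h2 := (hc s hs).swap.abs_flux_sub_le hM ((abs_sub_comm _ _).trans_le (hW s hs))
    (hz s hs) (hu s hs) (expect_sub_expect _) (expect_sub_expect _)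
  have h3 : C ≤ C * Real.exp (2 * q * s) :=
    le_mul_of_one_le_right hC0 (one_le_exp_mul (by positivity) hs.1)
  rw [h.expect_groupRate_eq, h.swap.expect_groupRate_eq]
  have h4 := (abs_le.1 h1).1
  have h5 := (abs_le.1 h2).2
  linarith

/-- By Cauchy–Schwarz the energy bound `hE` controls both mean absolute deviations by `G e^{qt}`;
together they force the single deviation at its own rate `q`. The `+ 2` strictly absorbs `5 * δ * M
≤ 1`. -/
lemma deviation_le (hq : 0 ≤ q) (hδ : 0 ≤ δ) (hδM : 5 * δ * M ≤ 1) {A G : ℝ} (hG : 0 ≤ G)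
    (hA : 0 ≤ A)
    (hE : ∀ t ∈ Set.Ico 0 T, (𝔼 i, (x t i - 𝔼 i', x t i') ^ 2)
      + 𝔼 j, (y t j - 𝔼 j', y t j') ^ 2 ≤ (G * Real.exp (q * t)) ^ 2)
    (i : ι) (h0 : x 0 i - 𝔼 i', x 0 i' ≤ A) {t : ℝ} (ht : t ∈ Set.Icc 0 T) :
    x t i - 𝔼 i', x t i' ≤ Real.exp (q * t) * (A + (2 * G + 2) * t) := by
  refine le_exp_mul_affine_of_deriv_right_lt (f := fun t => x t i - 𝔼 i', x t i')
    ((h.continuousOn_deviation i).mono Set.Icc_subset_Ici_self)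
    (fun s hs => h.hasDerivWithinAt_deviation i hs.1) h0 (fun s hs hs' => ?_) ht
  have hs0 := hs.1
  -- At a contact point the deviation equals the nonnegative barrier, which is the sign
  -- `deviation_rate_le` requires.
  have hpos : 0 ≤ x s i - 𝔼 i', x s i' := by
    rw [hs']; positivity
  have h1 := (hc s hs).deviation_rate_le (h.memX s) (h.memXY s) hδ hM (hW s hs)
    (hu s hs) (hz s hs) (expect_sub_expect _) (expect_sub_expect _) i hpos
  rw [← groupRate_eq_of_decomposition] at h1
  rw [h.expect_groupRate_eq, sub_neg_eq_add]
  have hE' := hE s hs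
  have n1 : 0 ≤ 𝔼 i, (x s i - 𝔼 i', x s i') ^ 2 := expect_nonneg fun i _ => sq_nonneg _
  have n2 : 0 ≤ 𝔼 j, (y s j - 𝔼 j', y s j') ^ 2 := expect_nonneg fun j _ => sq_nonneg _
  have h2 := expect_abs_le_of_expect_sq_le (u := fun i => x s i - 𝔼 i', x s i')
    (G := G * Real.exp (q * s)) (by positivity) (by linarith)
  have h3 := expect_abs_le_of_expect_sq_le (u := fun j => y s j - 𝔼 j', y s j')
    (G := G * Real.exp (q * s)) (by positivity) (by linarith)
  have h4 := one_le_exp_mul hq hs0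
  linarith

end Bounds

/-- Quasirandom repulsion separates the two groups in a time which depends only on `q` and on
the initial deviations. -/
theorem lt_of_isQuasirandom [Nonempty ι] [Nonempty κ] (h : IsTwoGroupFlow a b c x y)
    {L : ℝ} (hL : 0 ≤ L) (hT : 0 < T) (hq : 0 ≤ q) (hδ : 0 ≤ δ)
    (hM : M = 2 * ((1 + L) * Real.exp (4 * T)))
    (hc : ∀ t ∈ Set.Ico 0 T, IsQuasirandom δ q (c t))
    (hδ₁ : 12 * δ * M ^ 2 * T < 1) (hδ₂ : 12 * δ * M * T < 1) (hδ₃ : 5 * δ * M ≤ 1)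
    (hTL : 4 * (L + (4 * L + 4) * T) < Real.exp (q * T))
    (hx0 : 𝔼 i, x 0 i = 0) (hy0 : 𝔼 j, y 0 j = 1)
    (hx : ∀ i, |x 0 i - 𝔼 i', x 0 i'| ≤ L) (hy : ∀ j, |y 0 j - 𝔼 j', y 0 j'| ≤ L)
    (i : ι) (j : κ) : x T i < y T j := by
  have hM0 : 0 < M := by rw [hM]; positivity
  -- The factor 2 in `M` lets differences of opinions and means be bounded by `M`.
  have hsup : ∀ t ∈ Set.Ico 0 T, (∀ i, |x t i| ≤ M / 2) ∧ ∀ j, |y t j| ≤ M / 2 := by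
    intro t ht
    have := h.abs_le_mul_exp (R := 1 + L) (by positivity)
      (fun i => by have := hx i; rw [hx0, sub_zero] at this; linarith)
      (fun j => by
        have := hy j
        rw [hy0] at this
        calc |y 0 j| = |1 + (y 0 j - 1)| := by congr 1; ring
          _ ≤ |(1 : ℝ)| + |y 0 j - 1| := abs_add_le _ _
          _ ≤ 1 + L := by rw [abs_one]; linarith) ht.1
    have hle : (1 + L) * Real.exp (4 * t) ≤ M / 2 := by
      rw [hM, mul_div_cancel_left₀ _ two_ne_zero]
      gcongr
      exact ht.2.le
    exact ⟨fun i => (this.1 i).trans hle, fun j => (this.2 j).trans hle⟩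
  have hM2 : 0 ≤ M / 2 := by positivity
  have hW : ∀ t ∈ Set.Ico 0 T, |(𝔼 j, y t j) - 𝔼 i, x t i| ≤ M := fun t ht => by
    have h1 := abs_expect_le_of_forall_abs_le hM2 (hsup t ht).1
    have h2 := abs_expect_le_of_forall_abs_le hM2 (hsup t ht).2
    exact (abs_sub _ _).trans (by linarith)
  have hu : ∀ t ∈ Set.Ico 0 T, ∀ i, |x t i - 𝔼 i', x t i'| ≤ M := fun t ht i => by
    have h1 := abs_expect_le_of_forall_abs_le hM2 (hsup t ht).1
    exact (abs_sub _ _).trans (by linarith [(hsup t ht).1 i])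
  have hz : ∀ t ∈ Set.Ico 0 T, ∀ j, |y t j - 𝔼 j', y t j'| ≤ M := fun t ht j => by
    have h1 := abs_expect_le_of_forall_abs_le hM2 (hsup t ht).2
    exact (abs_sub _ _).trans (by linarith [(hsup t ht).2 j])
  have hE : ∀ t ∈ Set.Ico 0 T, (𝔼 i, (x t i - 𝔼 i', x t i') ^ 2)
      + 𝔼 j, (y t j - 𝔼 j', y t j') ^ 2 ≤ ((2 * L + 1) * Real.exp (q * t)) ^ 2 := by
    intro t ht
    have h0 : (𝔼 i, (x 0 i - 𝔼 i', x 0 i') ^ 2) + 𝔼 j, (y 0 j - 𝔼 j', y 0 j') ^ 2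
        ≤ L ^ 2 + L ^ 2 := add_le_add
      (expect_le univ_nonempty fun i _ => sq_le_sq' (abs_le.1 (hx i)).1 (abs_le.1 (hx i)).2)
      (expect_le univ_nonempty fun j _ => sq_le_sq' (abs_le.1 (hy j)).1 (abs_le.1 (hy j)).2)
    -- With `C = 1 / T` the error adds at most 1, and `2 * L ^ 2 + 1 ≤ (2 * L + 1) ^ 2`.
    have := h.energy_le hc hM0 hW hu hz hq (C := 1 / T) (by rwa [lt_div_iff₀ hT])
      (by positivity) h0 (Set.Ico_subset_Icc_self ht)
    have e : Real.exp (2 * q * t) = Real.exp (q * t) ^ 2 := by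
      rw [← Real.exp_nat_mul]; congr 1; push_cast; ring
    rw [e] at this
    have h1 : 1 / T * t ≤ 1 := by
      rw [one_div, inv_mul_le_iff₀ hT, mul_one]; exact ht.2.le
    refine this.trans ?_
    rw [mul_pow, mul_comm]
    gcongr
    nlinarith
  have hTT : T ∈ Set.Icc 0 T := ⟨hT.le, le_rfl⟩
  have hi := h.deviation_le hc hM0 hW hu hz hq hδ hδ₃ (A := L) (G := 2 * L + 1) (by positivity) hL
    hE i ((le_abs_self _).trans (hx i)) hTT
  have hneg : ∀ t, 𝔼 j', -y t j' = -𝔼 j', y t j' := fun t => expect_neg_distrib _ _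
  have hneg' : ∀ t, 𝔼 i', -x t i' = -𝔼 i', x t i' := fun t => expect_neg_distrib _ _
  -- Exchanging the groups and reflecting the line turns the lower deviations of `y` into upper
  -- ones.
  have hj := h.swap.neg.deviation_le (fun t ht => (hc t ht).swap) hM0
    (fun t ht => by rw [hneg, hneg', neg_sub_neg]; exact hW t ht)
    (fun t ht j => by rw [hneg, neg_sub_neg, abs_sub_comm]; exact hz t ht j)
    (fun t ht i => by rw [hneg', neg_sub_neg, abs_sub_comm]; exact hu t ht i)
    hq hδ hδ₃ (A := L) (G := 2 * L + 1) (by positivity) hL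
    (fun t ht => by
      have := hE t ht
      rw [add_comm] at this
      convert this using 3 with i _ i
      · rw [hneg]; ring
      · rw [hneg']; ring) j
    (by rw [hneg, neg_sub_neg, ← neg_sub]; exact (neg_le_abs _).trans (hy j)) hTT
  rw [hneg] at hj
  -- This `C` keeps half of `e^{2qT}`, to be compared with two deviations: hence the 4 in `hTL`.
  have hWT := h.exp_mul_le_expect_sub hc hM0 hW hu hz hq (C := 1 / (2 * T))
    (by rw [lt_div_iff₀ (by positivity)]; linarith) (by positivity) (by rw [hx0, hy0, sub_zero]) hTT
  have e : Real.exp (2 * q * T) = Real.exp (q * T) * Real.exp (q * T) := by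
    rw [← Real.exp_add]; congr 1; ring
  have e2 : 1 - 1 / (2 * T) * T = 1 / 2 := by field_simp; norm_num
  rw [e, e2] at hWT
  have := mul_lt_mul_of_pos_left hTL (Real.exp_pos (q * T))
  linarith

end IsTwoGroupFlow

end Separation

/-! ### Persistence of the separation. -/

section Invariance

open Finset
open scoped BigOperators

variable {ι κ : Type*} [Fintype ι] [Fintype κ]

/-- Squaring removes the corner of the positive part: the linearisation error is at most `(r - s) ^
2`. -/
lemma hasDerivAt_max_zero_sq (s : ℝ) :
    HasDerivAt (fun r : ℝ => max r 0 ^ 2) (2 * max s 0) s := by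
  rw [hasDerivAt_iff_isLittleO]
  refine Asymptotics.IsBigO.trans_isLittleO (g := fun r => (r - s) ^ 2) ?_ ?_
  · refine Asymptotics.IsBigO.of_bound 1 (Filter.Eventually.of_forall fun r => ?_)
    rw [one_mul, Real.norm_eq_abs, Real.norm_eq_abs, abs_of_nonneg (sq_nonneg (r - s)), abs_le,
      smul_eq_mul]
    rcases le_total r 0 with hr | hr <;> rcases le_total s 0 with hs | hs <;>
      simp only [max_eq_left, max_eq_right, hr, hs] <;> constructor <;> nlinarith
  · have h : (fun r : ℝ => r - s) =o[nhds s] fun _ => (1 : ℝ) := by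
      rw [Asymptotics.isLittleO_one_iff]
      have : Filter.Tendsto (fun r : ℝ => r - s) (nhds s) (nhds (s - s)) :=
        (continuous_id.sub continuous_const).tendsto s
      rwa [sub_self] at this
    simpa [sq] using h.mul_isBigO (Asymptotics.isBigO_refl (fun r : ℝ => r - s) (nhds s))

/-- Someone beyond `α` is pushed further only by those still further out, or by members of the other
group below `x i`, whose distance is at most the sum of the two excesses because `α ≤ β`. Products
of excesses are bounded by `V`. -/
lemma max_mul_groupRate_le [Nonempty ι] [Nonempty κ] {a : ι → ι → ℝ} {c : ι → κ → ℝ} {x : ι → ℝ}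
    {y : κ → ℝ} (ha : ∀ i i', a i i' ∈ Set.Icc (0 : ℝ) 1) (hc : ∀ i j, c i j ∈ Set.Icc (0 : ℝ) 1)
    {α β V : ℝ} (hαβ : α ≤ β) (hx : ∀ i, max (x i - α) 0 ^ 2 ≤ V)
    (hy : ∀ j, max (β - y j) 0 ^ 2 ≤ V) (i : ι) :
    max (x i - α) 0 * groupRate a c x y i ≤ 3 * V := by
  have hV : 0 ≤ V := (sq_nonneg _).trans (hx i)
  rcases le_total (x i - α) 0 with hi | hi
  · rw [max_eq_right hi, zero_mul]; positivity
  have hxi := hx i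
  rw [max_eq_left hi] at hxi ⊢
  have h1 : 𝔼 i', (x i - α) * (a i i' * (x i' - x i)) ≤ V := by
    refine expect_le univ_nonempty fun i' _ => ?_
    have h1 := hx i'
    have h2 := ha i i'
    have h3 := le_max_left (x i' - α) 0
    have h4 := le_max_right (x i' - α) 0
    have h5 : a i i' * (x i' - x i) ≤ max (x i' - α) 0 := by
      nlinarith [h2.1, h2.2, mul_nonneg h2.1 hi, mul_le_mul_of_nonneg_left h3 h2.1]
    nlinarith [mul_le_mul_of_nonneg_left h5 hi, sq_nonneg (max (x i' - α) 0 - (x i - α))]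
  have h2 : 𝔼 j, (x i - α) * -(c i j * (y j - x i)) ≤ 2 * V := by
    refine expect_le univ_nonempty fun j _ => ?_
    have h1 := hy j
    have h2 := hc i j
    have h3 := le_max_left (β - y j) 0
    have h4 := le_max_right (β - y j) 0
    have h5 : -(c i j * (y j - x i)) ≤ max (β - y j) 0 + (x i - α) := by
      have : -(y j - x i) ≤ max (β - y j) 0 + (x i - α) := by linarith
      calc -(c i j * (y j - x i)) = c i j * -(y j - x i) := by ring
        _ ≤ c i j * (max (β - y j) 0 + (x i - α)) := mul_le_mul_of_nonneg_left this h2.1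
        _ ≤ _ := mul_le_of_le_one_left (by positivity) h2.2
    nlinarith [mul_le_mul_of_nonneg_left h5 hi, sq_nonneg (max (β - y j) 0 - (x i - α))]
  simp only [← mul_expect, expect_neg_distrib] at h1 h2
  rw [groupRate]
  linarith

/-- Once two half-lines separate the groups, they do so forever, whatever the coefficients. -/
theorem IsTwoGroupFlow.le_and_le_of_le [Nonempty ι] [Nonempty κ] {a : ℝ → ι → ι → ℝ}
    {b : ℝ → κ → κ → ℝ} {c : ℝ → ι → κ → ℝ} {x : ℝ → ι → ℝ} {y : ℝ → κ → ℝ}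
    (h : IsTwoGroupFlow a b c x y) {T α β : ℝ} (hT : 0 ≤ T) (hαβ : α ≤ β)
    (hx : ∀ i, x T i ≤ α) (hy : ∀ j, β ≤ y T j) {t : ℝ} (ht : T ≤ t) :
    (∀ i, x t i ≤ α) ∧ ∀ j, β ≤ y t j := by
  -- Total squared violation of the two half-lines: it vanishes at `T` and satisfies `V' ≤ K V`, so
  -- it stays zero. The dependence of `K` on the group sizes is harmless.
  set V : ℝ → ℝ := fun t => (∑ i, max (x t i - α) 0 ^ 2) + ∑ j, max (β - y t j) 0 ^ 2 with hV
  have hxV : ∀ t i, max (x t i - α) 0 ^ 2 ≤ V t := fun t i =>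
    (single_le_sum (f := fun i => max (x t i - α) 0 ^ 2) (fun _ _ => sq_nonneg _)
      (mem_univ i)).trans (le_add_of_nonneg_right (sum_nonneg fun _ _ => sq_nonneg _))
  have hyV : ∀ t j, max (β - y t j) 0 ^ 2 ≤ V t := fun t j =>
    (single_le_sum (f := fun j => max (β - y t j) 0 ^ 2) (fun _ _ => sq_nonneg _)
      (mem_univ j)).trans (le_add_of_nonneg_left (sum_nonneg fun _ _ => sq_nonneg _))
  have hcont : ContinuousOn V (Set.Icc T t) := by
    have hsub : Set.Icc T t ⊆ Set.Ici 0 := fun s hs => hT.trans hs.1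
    refine ContinuousOn.add (continuousOn_finsetSum _ fun i _ => ?_)
      (continuousOn_finsetSum _ fun j _ => ?_)
    · exact ((((h.contX i).mono hsub).sub continuousOn_const).sup continuousOn_const).pow 2
    · exact ((continuousOn_const.sub ((h.contY j).mono hsub)).sup continuousOn_const).pow 2
  have hderiv : ∀ s ∈ Set.Ico T t, HasDerivWithinAt V
      ((∑ i, 2 * max (x s i - α) 0 * groupRate (a s) (c s) (x s) (y s) i)
        + ∑ j, 2 * max (β - y s j) 0 * -groupRate (b s) (fun j i => c s i j) (y s) (x s) j)
      (Set.Ici s) s := by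
    intro s hs
    have hs0 := hT.trans hs.1
    refine HasDerivWithinAt.fun_add (HasDerivWithinAt.fun_sum fun i _ => ?_)
      (HasDerivWithinAt.fun_sum fun j _ => ?_)
    · exact (hasDerivAt_max_zero_sq _).comp_hasDerivWithinAt s ((h.derivX i s hs0).sub_const α)
    · exact (hasDerivAt_max_zero_sq _).comp_hasDerivWithinAt s ((h.derivY j s hs0).const_sub β)
  have hbound : ∀ s ∈ Set.Ico T t,
      (∑ i, 2 * max (x s i - α) 0 * groupRate (a s) (c s) (x s) (y s) i)
        + ∑ j, 2 * max (β - y s j) 0 * -groupRate (b s) (fun j i => c s i j) (y s) (x s) j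
      ≤ (6 * Fintype.card ι + 6 * Fintype.card κ) * V s + 0 := by
    intro s _
    have h1 : ∀ i ∈ univ, 2 * max (x s i - α) 0 * groupRate (a s) (c s) (x s) (y s) i
        ≤ 6 * V s := fun i _ => by
      linarith [max_mul_groupRate_le (h.memX s) (h.memXY s) hαβ (hxV s) (hyV s) i]
    have h2 : ∀ j ∈ univ, 2 * max (β - y s j) 0
        * -groupRate (b s) (fun j i => c s i j) (y s) (x s) j ≤ 6 * V s := fun j _ => by
      have := max_mul_groupRate_le (x := fun j => -y s j) (y := fun i => -x s i) (α := -β)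
        (β := -α) (h.memY s) (fun j i => h.memXY s i j) (neg_le_neg hαβ)
        (fun j => by simpa only [neg_sub_neg] using hyV s j)
        (fun i => by simpa only [neg_sub_neg] using hxV s i) j
      rw [groupRate_neg, neg_sub_neg] at this
      linarith
    have h3 := add_le_add (sum_le_card_nsmul _ _ _ h1) (sum_le_card_nsmul _ _ _ h2)
    simp only [card_univ, nsmul_eq_mul] at h3
    linarith
  have key := le_gronwallBound_of_liminf_deriv_right_le hcont
    (fun s hs r hr => (hderiv s hs).liminf_right_slope_le hr) (δ := 0)
    (by simp [hV, hx, hy]) hbound t ⟨ht, le_rfl⟩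
  rw [gronwallBound_ε0, zero_mul] at key
  constructor
  · intro i
    have h1 := pow_eq_zero_iff two_ne_zero |>.1 (((hxV t i).trans key).antisymm (sq_nonneg _))
    linarith [le_max_left (x t i - α) 0]
  · intro j
    have h1 := pow_eq_zero_iff two_ne_zero |>.1 (((hyV t j).trans key).antisymm (sq_nonneg _))
    linarith [le_max_left (β - y t j) 0]

end Invariance

/-! ### Quasirandomness of Bernoulli tables. -/

section Concentration

open Finset
open scoped BigOperators

variable {ι κ : Type*} [Fintype ι] [Fintype κ]

/-- The sign `1` or `-1` encoded by a Boolean. -/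
def boolSign (b : Bool) : ℝ := if b then 1 else -1

lemma boolSign_sq (b : Bool) : boolSign b ^ 2 = 1 := by
  cases b <;> simp [boolSign]

lemma exists_sum_mul_le_sum_mul_boolSign (a f : ι → ℝ) (hf : ∀ i, |f i| ≤ 1) :
    ∃ s : ι → Bool, ∑ i, a i * f i ≤ ∑ i, a i * boolSign (s i) := by
  refine ⟨fun i => decide (0 ≤ a i), sum_le_sum fun i _ => ?_⟩
  have := abs_le.1 (hf i)
  by_cases h : 0 ≤ a i
  · simp only [boolSign, h, decide_true, if_true]; nlinarith
  · simp only [boolSign, h, decide_false, Bool.false_eq_true, if_false]; nlinarith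

/-- A bilinear form on a product of cubes is maximal at vertices: optimise `f` first, then `g`. This
leaves finitely many events for the union bound. -/
lemma sum_sum_mul_lt_of_boolSign {d : ι → κ → ℝ} {B : ℝ}
    (h : ∀ (s : ι → Bool) (r : κ → Bool),
      ∑ i, ∑ j, boolSign (s i) * boolSign (r j) * d i j < B)
    {f : ι → ℝ} {g : κ → ℝ} (hf : ∀ i, |f i| ≤ 1) (hg : ∀ j, |g j| ≤ 1) :
    ∑ i, ∑ j, d i j * (f i * g j) < B := by
  obtain ⟨s, hs⟩ := exists_sum_mul_le_sum_mul_boolSign (fun i => ∑ j, d i j * g j) f hf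
  obtain ⟨r, hr⟩ := exists_sum_mul_le_sum_mul_boolSign
    (fun j => ∑ i, d i j * boolSign (s i)) g hg
  calc ∑ i, ∑ j, d i j * (f i * g j) = ∑ i, (∑ j, d i j * g j) * f i :=
        sum_congr rfl fun i _ => by
          rw [sum_mul]; exact sum_congr rfl fun j _ => by ring
    _ ≤ ∑ i, (∑ j, d i j * g j) * boolSign (s i) := hs
    _ = ∑ j, (∑ i, d i j * boolSign (s i)) * g j := by
        simp only [sum_mul]
        rw [sum_comm]
        exact sum_congr rfl fun j _ => sum_congr rfl fun i _ => by ring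
    _ ≤ ∑ j, (∑ i, d i j * boolSign (s i)) * boolSign (r j) := hr
    _ = ∑ i, ∑ j, boolSign (s i) * boolSign (r j) * d i j := by
        simp only [sum_mul]
        rw [sum_comm]
        exact sum_congr rfl fun j _ => sum_congr rfl fun i _ => by ring
    _ < B := h s r

lemma abs_expect_le_of_boolSign [Nonempty ι] {d : ι → ℝ} {δ : ℝ}
    (h : ∀ b, ∑ i, boolSign b * d i < δ * Fintype.card ι) : |𝔼 i, d i| ≤ δ := by
  have hc : (0 : ℝ) < Fintype.card ι := by exact_mod_cast Fintype.card_pos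
  have h1 := h true
  have h2 := h false
  simp only [boolSign, ← mul_sum, if_true, Bool.false_eq_true, if_false] at h1 h2
  rw [Fintype.expect_eq_sum_div_card, abs_le, le_div_iff₀ hc, div_le_iff₀ hc]
  constructor <;> linarith

lemma isQuasirandom_of_boolSign [Nonempty ι] [Nonempty κ] {δ q : ℝ} {c : ι → κ → ℝ}
    (hrow : ∀ i b, ∑ j, boolSign b * (c i j - q) < δ * Fintype.card κ)
    (hcol : ∀ j b, ∑ i, boolSign b * (c i j - q) < δ * Fintype.card ι)
    (hcut : ∀ (s : ι → Bool) (r : κ → Bool), ∑ i, ∑ j, boolSign (s i) * boolSign (r j)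
      * (c i j - q) < δ * (Fintype.card ι * Fintype.card κ)) : IsQuasirandom δ q c where
  row i := abs_expect_le_of_boolSign (hrow i)
  col j := abs_expect_le_of_boolSign (hcol j)
  cut f g hf hg := by
    have hι : (0 : ℝ) < Fintype.card ι := by exact_mod_cast Fintype.card_pos
    have hκ : (0 : ℝ) < Fintype.card κ := by exact_mod_cast Fintype.card_pos
    have h1 := sum_sum_mul_lt_of_boolSign hcut hf hg
    -- Flipping the sign of `f` gives the lower bound.
    have h2 := sum_sum_mul_lt_of_boolSign hcut (f := fun i => -f i)
      (fun i => by rw [abs_neg]; exact hf i) hg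
    simp only [neg_mul, mul_neg, sum_neg_distrib] at h2
    simp only [Fintype.expect_eq_sum_div_card, ← sum_div]
    rw [div_div, abs_le, le_div_iff₀ (by positivity), div_le_iff₀ (by positivity)]
    constructor <;> nlinarith

variable {Ω : Type*} [MeasurableSpace Ω] {P : Measure Ω} [IsProbabilityMeasure P]

lemma ae_mem_Icc_of_hasLaw_bernoulli {X : Ω → ℝ} {q : unitInterval}
    (h : HasLaw X (bernoulliMeasure (1 : ℝ) 0 q) P) : ∀ᵐ ω ∂P, X ω ∈ Set.Icc (0 : ℝ) 1 := by
  have h1 := h.measure_eq (p := fun r => r ∈ Set.Icc (0 : ℝ) 1) measurableSet_Icc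
  rw [show {r : ℝ | r ∈ Set.Icc (0 : ℝ) 1} = Set.Icc 0 1 from rfl,
    bernoulliMeasure_apply_of_mem_of_mem _ measurableSet_Icc (by simp) (by simp)] at h1
  have h2 : NullMeasurableSet {ω | X ω ∈ Set.Icc (0 : ℝ) 1} P :=
    h.aemeasurable.nullMeasurableSet_preimage measurableSet_Icc
  rwa [← prob_compl_eq_zero_iff₀ h2] at h1

/-- Hoeffding's inequality for signed sums of independent centered Bernoulli variables. -/
lemma measureReal_sum_sign_ge_le {L : Type*} {Z : L → Ω → ℝ} {q : unitInterval}
    (hlaw : ∀ l, HasLaw (Z l) (bernoulliMeasure (1 : ℝ) 0 q) P) (hind : iIndepFun Z P)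
    (w : L → ℝ) (hw : ∀ l, w l ^ 2 = 1) (s : Finset L) {δ : ℝ} (hδ : 0 ≤ δ) :
    P.real {ω | δ * #s ≤ ∑ l ∈ s, w l * (Z l ω - q)} ≤ Real.exp (-(2 * δ ^ 2 * #s)) := by
  have hmean : ∀ l, P[Z l] = (q : ℝ) := fun l => by
    rw [(hlaw l).integral_eq]
    simpa using integral_bernoulliMeasure (1 : ℝ) 0 q (fun z : ℝ => z)
  have hsub : ∀ l ∈ s, HasSubgaussianMGF (fun ω => w l * (Z l ω - q)) (1 / 4) P := fun l _ => by
    have h1 := (hasSubgaussianMGF_of_mem_Icc (hlaw l).aemeasurable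
      (ae_mem_Icc_of_hasLaw_bernoulli (hlaw l))).const_mul (w l)
    rw [hmean] at h1
    convert h1 using 1
    ext
    -- Hoeffding's lemma: the variance proxy is the squared half-length of `[0, 1]`.
    change ((1 / 4 : NNReal) : ℝ) = w l ^ 2 * (‖(1 : ℝ) - 0‖ / 2) ^ 2
    rw [hw l]
    norm_num
  have hind' : iIndepFun (fun l ω => w l * (Z l ω - q)) P :=
    hind.comp (fun l r => w l * (r - q)) fun l => by fun_prop
  refine (HasSubgaussianMGF.measure_sum_ge_le_of_iIndepFun hind' hsub (by positivity)).trans_eq ?_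
  congr 1
  rcases s.eq_empty_or_nonempty with rfl | hs
  · simp
  · have : (#s : ℝ) ≠ 0 := by exact_mod_cast hs.card_pos.ne'
    simp only [sum_const, nsmul_eq_mul]
    push_cast
    field_simp
    norm_num

/-- A Bernoulli table is quasirandom with overwhelming probability. -/
theorem measureReal_not_isQuasirandom_le [Nonempty ι] [Nonempty κ] {Z : ι × κ → Ω → ℝ}
    {q : unitInterval} (hlaw : ∀ l, HasLaw (Z l) (bernoulliMeasure (1 : ℝ) 0 q) P)
    (hind : iIndepFun Z P) {δ : ℝ} (hδ : 0 ≤ δ) :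
    P.real {ω | ¬ IsQuasirandom δ q (fun i j => Z (i, j) ω)}
      ≤ 2 * Fintype.card ι * Real.exp (-(2 * δ ^ 2 * Fintype.card κ))
        + 2 * Fintype.card κ * Real.exp (-(2 * δ ^ 2 * Fintype.card ι))
        + 2 ^ Fintype.card ι * 2 ^ Fintype.card κ
          * Real.exp (-(2 * δ ^ 2 * (Fintype.card ι * Fintype.card κ))) := by
  classical
  set R : Set Ω := ⋃ e : ι × Bool,
    {ω | δ * Fintype.card κ ≤ ∑ j, boolSign e.2 * (Z (e.1, j) ω - q)} with hR
  set C : Set Ω := ⋃ e : κ × Bool,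
    {ω | δ * Fintype.card ι ≤ ∑ i, boolSign e.2 * (Z (i, e.1) ω - q)} with hC
  set D : Set Ω := ⋃ e : (ι → Bool) × (κ → Bool),
    {ω | δ * (Fintype.card ι * Fintype.card κ)
      ≤ ∑ i, ∑ j, boolSign (e.1 i) * boolSign (e.2 j) * (Z (i, j) ω - q)} with hD
  have hsub : {ω | ¬ IsQuasirandom δ q (fun i j => Z (i, j) ω)} ⊆ R ∪ C ∪ D := by
    intro ω hω
    by_contra hcon
    simp only [hR, hC, hD, Set.mem_union, Set.mem_iUnion, Set.mem_ofPred_eq, not_or, not_exists,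
      not_le, Prod.forall] at hcon
    exact hω (isQuasirandom_of_boolSign hcon.1.1 hcon.1.2 hcon.2)
  have bR : P.real R ≤ 2 * Fintype.card ι * Real.exp (-(2 * δ ^ 2 * Fintype.card κ)) := by
    refine (measureReal_iUnion_fintype_le _).trans ?_
    refine (sum_le_card_nsmul univ _ (Real.exp (-(2 * δ ^ 2 * Fintype.card κ)))
      fun e _ => ?_).trans_eq (by simp [mul_comm])
    have := measureReal_sum_sign_ge_le (fun j => hlaw (e.1, j))
      (hind.precomp (g := fun j => (e.1, j)) (Prod.mk_right_injective e.1))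
      (fun _ => boolSign e.2) (fun _ => boolSign_sq _) univ hδ
    simpa using this
  have bC : P.real C ≤ 2 * Fintype.card κ * Real.exp (-(2 * δ ^ 2 * Fintype.card ι)) := by
    refine (measureReal_iUnion_fintype_le _).trans ?_
    refine (sum_le_card_nsmul univ _ (Real.exp (-(2 * δ ^ 2 * Fintype.card ι)))
      fun e _ => ?_).trans_eq (by simp [mul_comm])
    have := measureReal_sum_sign_ge_le (fun i => hlaw (i, e.1))
      (hind.precomp (g := fun i => (i, e.1)) (Prod.mk_left_injective e.1))
      (fun _ => boolSign e.2) (fun _ => boolSign_sq _) univ hδ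
    simpa using this
  have bD : P.real D ≤ 2 ^ Fintype.card ι * 2 ^ Fintype.card κ
          * Real.exp (-(2 * δ ^ 2 * (Fintype.card ι * Fintype.card κ))) := by
    refine (measureReal_iUnion_fintype_le _).trans ?_
    refine (sum_le_card_nsmul univ _
      (Real.exp (-(2 * δ ^ 2 * (Fintype.card ι * Fintype.card κ))))
      fun e _ => ?_).trans_eq (by simp)
    have := measureReal_sum_sign_ge_le hlaw hind
      (fun l => boolSign (e.1 l.1) * boolSign (e.2 l.2))
      (fun _ => by rw [mul_pow, boolSign_sq, boolSign_sq, one_mul]) univ hδ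
    simpa [Fintype.sum_prod_type] using this
  calc _ ≤ P.real (R ∪ C ∪ D) := measureReal_mono hsub
    _ ≤ P.real R + P.real C + P.real D :=
      (measureReal_union_le _ _).trans (add_le_add_left (measureReal_union_le _ _) _)
    _ ≤ _ := add_le_add (add_le_add bR bC) bD

/-- Comparable sizes turn the first two terms into `n e^{-cn}`. In the third, the number of sign
patterns is exponential in `N₁ + N₂`, the gain exponential in `N₁ * N₂`. -/
lemma exists_forall_quasirandom_bound_le {δ K η : ℝ} (hδ : 0 < δ) (hK : 0 < K) (hη : 0 < η) :
    ∃ N₀ : ℕ, 0 < N₀ ∧ ∀ N₁ N₂ : ℕ, N₀ ≤ N₁ → N₀ ≤ N₂ → (N₁ : ℝ) ≤ K * N₂ → (N₂ : ℝ) ≤ K * N₁ →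
      2 * N₁ * Real.exp (-(2 * δ ^ 2 * N₂)) + 2 * N₂ * Real.exp (-(2 * δ ^ 2 * N₁))
        + 2 ^ N₁ * 2 ^ N₂ * Real.exp (-(2 * δ ^ 2 * (N₁ * N₂))) ≤ η := by
  have hlim : Filter.Tendsto (fun n : ℕ => 2 * K * ((n : ℝ) * Real.exp (-(2 * δ ^ 2 * n))))
      Filter.atTop (nhds 0) := by
    have h := (Real.tendsto_pow_mul_exp_neg_atTop_nhds_zero 1).comp
      ((Filter.tendsto_id.const_mul_atTop (show 0 < 2 * δ ^ 2 by positivity)).comp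
        tendsto_natCast_atTop_atTop)
    have h' := h.const_mul (2 * K / (2 * δ ^ 2))
    rw [mul_zero] at h'
    refine h'.congr fun n => ?_
    simp only [Function.comp_apply, id, pow_one]
    field_simp
  have hexp : Filter.Tendsto (fun n : ℕ => Real.exp (-(n : ℝ))) Filter.atTop (nhds 0) :=
    Real.tendsto_exp_neg_atTop_nhds_zero.comp tendsto_natCast_atTop_atTop
  obtain ⟨A, hA⟩ := Filter.eventually_atTop.1
    ((hlim.eventually (gt_mem_nhds (show 0 < η / 3 by positivity))).and
      (hexp.eventually (gt_mem_nhds (show 0 < η / 3 by positivity))))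
  -- Sizes above `2 / δ ^ 2` give `2 δ² N₁ N₂ ≥ 2 N₁ + 2 N₂`, which beats `2 ^ (N₁ + N₂)`.
  obtain ⟨B, hB⟩ := exists_nat_ge (2 / δ ^ 2)
  refine ⟨max (max A B) 1, by positivity, fun N₁ N₂ h1 h2 h12 h21 => ?_⟩
  simp only [max_le_iff] at h1 h2
  have hN1 := hA N₁ h1.1.1
  have hN2 := hA N₂ h2.1.1
  have t1 : 2 * N₁ * Real.exp (-(2 * δ ^ 2 * N₂)) ≤ η / 3 := by
    refine le_trans ?_ hN2.1.le
    rw [← mul_assoc]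
    gcongr ?_ * _
    linarith
  have t2 : 2 * N₂ * Real.exp (-(2 * δ ^ 2 * N₁)) ≤ η / 3 := by
    refine le_trans ?_ hN1.1.le
    rw [← mul_assoc]
    gcongr ?_ * _
    linarith
  have t3 : 2 ^ N₁ * 2 ^ N₂ * Real.exp (-(2 * δ ^ 2 * (N₁ * N₂))) ≤ η / 3 := by
    refine le_trans ?_ hN1.2.le
    have he : (2 : ℝ) ≤ Real.exp 1 := by linarith [Real.add_one_le_exp (1 : ℝ)]
    have p1 : (2 : ℝ) ^ N₁ ≤ Real.exp N₁ := by
      rw [← mul_one (N₁ : ℝ), Real.exp_nat_mul]; gcongr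
    have p2 : (2 : ℝ) ^ N₂ ≤ Real.exp N₂ := by
      rw [← mul_one (N₂ : ℝ), Real.exp_nat_mul]; gcongr
    calc (2 : ℝ) ^ N₁ * 2 ^ N₂ * Real.exp (-(2 * δ ^ 2 * (N₁ * N₂)))
        ≤ Real.exp N₁ * Real.exp N₂ * Real.exp (-(2 * δ ^ 2 * (N₁ * N₂))) := by gcongr
      _ = Real.exp (N₁ + N₂ - 2 * δ ^ 2 * (N₁ * N₂)) := by
          rw [← Real.exp_add, ← Real.exp_add]; rfl
      _ ≤ Real.exp (-(N₁ : ℝ)) := by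
          refine Real.exp_le_exp.2 ?_
          have d0 : 0 < δ ^ 2 := by positivity
          have hb1 : (2 : ℝ) ≤ δ ^ 2 * N₁ := by
            have : (B : ℝ) ≤ N₁ := by exact_mod_cast h1.1.2
            rw [← div_le_iff₀' d0]; linarith
          have hb2 : (2 : ℝ) ≤ δ ^ 2 * N₂ := by
            have : (B : ℝ) ≤ N₂ := by exact_mod_cast h2.1.2
            rw [← div_le_iff₀' d0]; linarith
          nlinarith [mul_le_mul_of_nonneg_right hb1 (Nat.cast_nonneg (α := ℝ) N₂),
            mul_le_mul_of_nonneg_right hb2 (Nat.cast_nonneg (α := ℝ) N₁)]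
  linarith

end Concentration

/-! ### From opinions in `ℝ^d` to a scalar flow. -/

section Projection

open Finset
open scoped BigOperators

/-- Diagonal coefficients are set to 0: they do not affect the velocity, and nothing confines the
original ones to `[0, 1]`. -/
lemma inner_velocity_div_eq_groupRate {N₁ N₂ d : ℕ} (a : Fin N₁ → Fin N₁ → ℝ)
    (c : Fin N₁ → Fin N₂ → ℝ) (x : Fin N₁ → Opinion d) (y : Fin N₂ → Opinion d)
    (m v : Opinion d) (r : ℝ) (i : Fin N₁) :
    inner ℝ ((1 / (N₁ : ℝ)) • ∑ i' ∈ univ.erase i, a i i' • (x i' - x i)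
      - (1 / (N₂ : ℝ)) • ∑ j, c i j • (y j - x i)) v / r
      = groupRate (fun i i' => if i = i' then 0 else a i i') c
          (fun i => inner ℝ (x i - m) v / r) (fun j => inner ℝ (y j - m) v / r) i := by
  have h1 : ∑ i' ∈ univ.erase i, a i i' * inner ℝ (x i' - x i) v
      = ∑ i', (if i = i' then 0 else a i i') * inner ℝ (x i' - x i) v := by
    rw [← add_sum_erase univ _ (mem_univ i)]
    simp only [if_true, zero_mul, zero_add]
    exact sum_congr rfl fun i' hi' => by rw [if_neg (ne_of_mem_erase hi').symm]
  have h2 : ∀ z : Opinion d, inner ℝ (z - m) v / r - inner ℝ (x i - m) v / r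
      = inner ℝ (z - x i) v / r := fun z => by
    rw [← sub_div, ← inner_sub_left, sub_sub_sub_cancel_right]
  rw [inner_sub_left]
  simp only [groupRate, h2, Fintype.expect_eq_sum_div_card, Fintype.card_fin,
    real_inner_smul_left, sum_inner, h1, mul_div_assoc', ← sum_div]
  ring

lemma expect_inner_div {N d : ℕ} [Nonempty (Fin N)] (x : Fin N → Opinion d) (m v : Opinion d)
    (r : ℝ) : 𝔼 i, inner ℝ (x i - m) v / r = inner ℝ (meanLocation x - m) v / r := by
  simp only [← expect_div, inner_sub_left, expect_sub_distrib, Fintype.expect_const]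
  rw [meanLocation, real_inner_smul_left, sum_inner, Fintype.expect_eq_sum_div_card,
    Fintype.card_fin, one_div, div_eq_inv_mul _ (N : ℝ)]

lemma sq_norm_deviation_le {N₁ N₂ d : ℕ} {x : Fin N₁ → Opinion d} {y : Fin N₂ → Opinion d} {Λ : ℝ}
    (hne : meanLocation x ≠ meanLocation y) (h : deviationRatio x y ≤ Λ) :
    (∀ i, ‖deviation x i‖ ^ 2 ≤ Λ * ‖meanLocation y - meanLocation x‖ ^ 2) ∧
      ∀ j, ‖deviation y j‖ ^ 2 ≤ Λ * ‖meanLocation y - meanLocation x‖ ^ 2 := by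
  have hpos : 0 < ‖meanLocation x - meanLocation y‖ ^ 2 :=
    pow_pos (norm_pos_iff.2 (sub_ne_zero.2 hne)) 2
  rw [deviationRatio, div_le_iff₀ hpos, norm_sub_rev] at h
  have h1 : 0 ≤ ⨆ i, ‖deviation x i‖ ^ 2 := Real.iSup_nonneg fun i => sq_nonneg _
  have h2 : 0 ≤ ⨆ j, ‖deviation y j‖ ^ 2 := Real.iSup_nonneg fun j => sq_nonneg _
  constructor
  · intro i
    have := le_ciSup (f := fun i => ‖deviation x i‖ ^ 2) (Set.finite_range _).bddAbove i
    exact this.trans (by linarith)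
  · intro j
    have := le_ciSup (f := fun j => ‖deviation y j‖ ^ 2) (Set.finite_range _).bddAbove j
    exact this.trans (by linarith)

lemma abs_inner_div_le {d : ℕ} {u v : Opinion d} {r Λ : ℝ} (hv : ‖v‖ = 1) (hr : 0 < r)
    (hΛ : 0 ≤ Λ) (h : ‖u‖ ^ 2 ≤ Λ * r ^ 2) : |inner ℝ u v / r| ≤ √Λ := by
  rw [abs_div, abs_of_pos hr, div_le_iff₀ hr]
  calc |inner ℝ u v| ≤ ‖u‖ * ‖v‖ := abs_real_inner_le_norm u v
    _ = ‖u‖ := by rw [hv, mul_one]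
    _ ≤ √Λ * r := by
      refine le_of_sq_le_sq ?_ (by positivity)
      rwa [mul_pow, Real.sq_sqrt hΛ]

/-- All coefficients of distinct people lie in `[0, 1]`, and the table is symmetric. -/
structure Coefficients.IsAdmissible {N₁ N₂ : ℕ} (c : Coefficients N₁ N₂) : Prop where
  symmX : ∀ i i', c.withinX i i' = c.withinX i' i
  symmY : ∀ j j', c.withinY j j' = c.withinY j' j
  mem : ∀ l, c.value l ∈ Set.Icc (0 : ℝ) 1

lemma Coefficients.IsAdmissible.withinX_mem {N₁ N₂ : ℕ} {c : Coefficients N₁ N₂}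
    (h : c.IsAdmissible) {i i' : Fin N₁} (hi : i ≠ i') : c.withinX i i' ∈ Set.Icc (0 : ℝ) 1 := by
  rcases hi.lt_or_gt with hlt | hlt
  · exact h.mem (.inl ⟨(i, i'), hlt⟩)
  · rw [h.symmX]
    exact h.mem (.inl ⟨(i', i), hlt⟩)

lemma Coefficients.IsAdmissible.withinY_mem {N₁ N₂ : ℕ} {c : Coefficients N₁ N₂}
    (h : c.IsAdmissible) {j j' : Fin N₂} (hj : j ≠ j') : c.withinY j j' ∈ Set.Icc (0 : ℝ) 1 := by
  rcases hj.lt_or_gt with hlt | hlt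
  · exact h.mem (.inr (.inl ⟨(j, j'), hlt⟩))
  · rw [h.symmY]
    exact h.mem (.inr (.inl ⟨(j', j), hlt⟩))

/-- Projecting a solution on a direction gives a scalar two-group flow. -/
lemma IsSolution.isTwoGroupFlow {N₁ N₂ d : ℕ} {c : ℝ → Coefficients N₁ N₂}
    {x : ℝ → Fin N₁ → Opinion d} {y : ℝ → Fin N₂ → Opinion d} (h : IsSolution c x y)
    (hc : ∀ t, (c t).IsAdmissible) (m v : Opinion d) (r : ℝ) :
    IsTwoGroupFlow (fun t i i' => if i = i' then 0 else (c t).withinX i i')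
      (fun t j j' => if j = j' then 0 else (c t).withinY j j') (fun t => (c t).between)
      (fun t i => inner ℝ (x t i - m) v / r) (fun t j => inner ℝ (y t j - m) v / r) where
  symmX t i i' := by simp only [(hc t).symmX i i', eq_comm]
  symmY t j j' := by simp only [(hc t).symmY j j', eq_comm]
  memX t i i' := by
    split_ifs with hi
    · simp
    · exact (hc t).withinX_mem hi
  memY t j j' := by
    split_ifs with hj
    · simp
    · exact (hc t).withinY_mem hj
  memXY t i j := (hc t).mem (.inr (.inr (i, j)))
  contX i := (((h.contX i).sub continuousOn_const).inner continuousOn_const).div_const r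
  contY j := (((h.contY j).sub continuousOn_const).inner continuousOn_const).div_const r
  derivX i t ht := by
    rw [← inner_velocity_div_eq_groupRate]
    refine ((((h.derivX i t ht).sub_const m).inner ℝ
      (hasDerivWithinAt_const t _ v)).div_const r).congr_deriv ?_
    rw [inner_zero_right, zero_add, velocityX]
  derivY j t ht := by
    rw [← inner_velocity_div_eq_groupRate (c t).withinY (fun j i => (c t).between i j)]
    refine ((((h.derivY j t ht).sub_const m).inner ℝ
      (hasDerivWithinAt_const t _ v)).div_const r).congr_deriv ?_
    rw [inner_zero_right, zero_add, velocityY]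

lemma IsSolution.exists_isSeparatedBy {N₁ N₂ d : ℕ} [Nonempty (Fin N₁)] [Nonempty (Fin N₂)]
    {c : ℝ → Coefficients N₁ N₂}
    {x : ℝ → Fin N₁ → Opinion d} {y : ℝ → Fin N₂ → Opinion d} (h : IsSolution c x y)
    (hc : ∀ t, (c t).IsAdmissible) (hne : meanLocation (x 0) ≠ meanLocation (y 0))
    {Λ T M δ q : ℝ} (hΛ : 0 ≤ Λ) (hratio : deviationRatio (x 0) (y 0) ≤ Λ) (hT : 0 < T)
    (hq : 0 ≤ q) (hδ : 0 ≤ δ) (hM : M = 2 * ((1 + √Λ) * Real.exp (4 * T)))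
    (hquasi : ∀ t ∈ Set.Ico 0 T, IsQuasirandom δ q (c t).between)
    (hδ₁ : 12 * δ * M ^ 2 * T < 1) (hδ₂ : 12 * δ * M * T < 1) (hδ₃ : 5 * δ * M ≤ 1)
    (hTL : 4 * (√Λ + (4 * √Λ + 4) * T) < Real.exp (q * T)) :
    ∃ v : Opinion d, ‖v‖ = 1 ∧ ∀ t : ℝ, T ≤ t → IsSeparatedBy v (x t) (y t) := by
  set w := meanLocation (y 0) - meanLocation (x 0) with hw
  set m := meanLocation (x 0) with hm
  have hr : 0 < ‖w‖ := norm_pos_iff.2 (sub_ne_zero.2 hne.symm)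
  set v : Opinion d := ‖w‖⁻¹ • w with hv
  have hv1 : ‖v‖ = 1 := by
    rw [hv, norm_smul, norm_inv, norm_norm, inv_mul_cancel₀ hr.ne']
  have hwv : inner ℝ w v = ‖w‖ := by
    rw [hv, real_inner_smul_right, real_inner_self_eq_norm_sq]
    field_simp
  have hflow := h.isTwoGroupFlow hc m v ‖w‖
  have hdev := sq_norm_deviation_le hne hratio
  have hx0 : 𝔼 i, inner ℝ (x 0 i - m) v / ‖w‖ = 0 := by
    rw [expect_inner_div, hm, sub_self, inner_zero_left, zero_div]
  have hy0 : 𝔼 j, inner ℝ (y 0 j - m) v / ‖w‖ = 1 := by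
    rw [expect_inner_div, ← hw, hwv, div_self hr.ne']
  have hsub : ∀ u m' : Opinion d, inner ℝ (u - m) v / ‖w‖ - inner ℝ (m' - m) v / ‖w‖
      = inner ℝ (u - m') v / ‖w‖ := fun u m' => by
    rw [← sub_div, ← inner_sub_left, sub_sub_sub_cancel_right]
  have hlt := hflow.lt_of_isQuasirandom (Real.sqrt_nonneg Λ) hT hq hδ hM hquasi hδ₁ hδ₂ hδ₃ hTL
    hx0 hy0
    (fun i => by
      rw [expect_inner_div, hsub]
      exact abs_inner_div_le hv1 hr hΛ (hdev.1 i))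
    (fun j => by
      rw [expect_inner_div, hsub]
      exact abs_inner_div_le hv1 hr hΛ (hdev.2 j))
  refine ⟨v, hv1, fun t ht => ?_⟩
  -- The extreme projections at time `T` are the ends of the two half-lines; they stay fixed, so the
  -- strict gap between them persists.
  obtain ⟨i₀, hi₀⟩ := Finite.exists_max fun i => inner ℝ (x T i - m) v / ‖w‖
  obtain ⟨j₀, hj₀⟩ := Finite.exists_min fun j => inner ℝ (y T j - m) v / ‖w‖
  have hinv := hflow.le_and_le_of_le hT.le (hlt i₀ j₀).le hi₀ hj₀ ht
  obtain ⟨i, hi⟩ := exists_eq_ciSup_of_finite (f := fun i => inner ℝ (x t i) v)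
  obtain ⟨j, hj⟩ := exists_eq_ciInf_of_finite (f := fun j => inner ℝ (y t j) v)
  rw [IsSeparatedBy, ← hi, ← hj]
  have := ((hinv.1 i).trans_lt (hlt i₀ j₀)).trans_le (hinv.2 j)
  rw [div_lt_div_iff_of_pos_right hr, inner_sub_left, inner_sub_left] at this
  linarith

end Projection

/-! ### Choice of constants and the final probability estimate. -/

lemma exists_affine_lt_exp_mul {L q : ℝ} (hL : 0 ≤ L) (hq : 0 < q) :
    ∃ T : ℝ, 0 < T ∧ 4 * (L + (4 * L + 4) * T) < Real.exp (q * T) := by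
  -- As `T ≥ 1`, the left side is at most `20 (L + 1) T`; the quadratic term of the exponential
  -- exceeds this once `q² T > 40 (L + 1)`.
  refine ⟨1 + 41 * (L + 1) / q ^ 2, by positivity, ?_⟩
  set T := 1 + 41 * (L + 1) / q ^ 2 with hT
  have h1 : 1 ≤ T := le_add_of_nonneg_right (by positivity)
  have h2 : 41 * (L + 1) ≤ q ^ 2 * T := by
    have h : q ^ 2 * (41 * (L + 1) / q ^ 2) = 41 * (L + 1) := by field_simp
    rw [hT, mul_add (q ^ 2), h]
    exact le_add_of_nonneg_left (by positivity)
  have h3 := Real.quadratic_le_exp_of_nonneg (x := q * T) (by positivity)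
  have h4 : 0 ≤ q * T := by positivity
  nlinarith [mul_le_mul_of_nonneg_right h2 (zero_le_one.trans h1)]

lemma IsResampledBernoulli.measureReal_bad_le {N₁ N₂ : ℕ} [Nonempty (Fin N₁)] [Nonempty (Fin N₂)]
    {Ω : Type*} [MeasurableSpace Ω]
    {P : Measure Ω} [IsProbabilityMeasure P] {p q : unitInterval} {ψ : ℕ → Ω → Coefficients N₁ N₂}
    (h : IsResampledBernoulli P p q ψ) {δ η : ℝ} (hδ : 0 ≤ δ)
    (hη : 2 * N₁ * Real.exp (-(2 * δ ^ 2 * N₂)) + 2 * N₂ * Real.exp (-(2 * δ ^ 2 * N₁))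
        + 2 ^ N₁ * 2 ^ N₂ * Real.exp (-(2 * δ ^ 2 * (N₁ * N₂))) ≤ η) (n : ℕ) :
    P.real {ω | ¬ ((∀ k, (ψ k ω).IsAdmissible) ∧
      ∀ k < n, IsQuasirandom δ q (ψ k ω).between)} ≤ n * η := by
  have hadm : ∀ᵐ ω ∂P, ∀ k, (ψ k ω).IsAdmissible := by
    have : ∀ᵐ ω ∂P, ∀ k l, (ψ k ω).value l ∈ Set.Icc (0 : ℝ) 1 :=
      ae_all_iff.2 fun k => ae_all_iff.2 fun l => ae_mem_Icc_of_hasLaw_bernoulli (h.law k l)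
    filter_upwards [this] with ω hω k
    exact ⟨h.symmX k ω, h.symmY k ω, hω k⟩
  have hquasi : ∀ k, P.real {ω | ¬ IsQuasirandom δ q (ψ k ω).between} ≤ η := fun k => by
    refine le_trans ?_ hη
    have := measureReal_not_isQuasirandom_le
      (Z := fun (e : Fin N₁ × Fin N₂) ω => (ψ k ω).value (.inr (.inr e)))
      (fun e => h.law k (.inr (.inr e)))
      (h.indep.precomp (g := fun e => (k, .inr (.inr e)))
        fun e e' he => Sum.inr_injective (Sum.inr_injective (Prod.mk_right_injective k he))) hδ
    simp only [Fintype.card_fin] at this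
    exact this
  have hsub : {ω | ¬ ((∀ k, (ψ k ω).IsAdmissible) ∧ ∀ k < n, IsQuasirandom δ q (ψ k ω).between)}
      ⊆ {ω | ¬ ∀ k, (ψ k ω).IsAdmissible} ∪
        ⋃ k ∈ Finset.range n, {ω | ¬ IsQuasirandom δ q (ψ k ω).between} := by
    intro ω hω
    by_contra hcon
    simp only [Set.mem_union, Set.mem_iUnion, Set.mem_ofPred_eq, not_or, not_exists, not_not,
      Finset.mem_range] at hcon
    exact hω hcon
  have hzero : P.real {ω | ¬ ∀ k, (ψ k ω).IsAdmissible} = 0 := by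
    rw [measureReal_def, ae_iff.1 hadm, ENNReal.toReal_zero]
  calc _ ≤ _ := measureReal_mono hsub
    _ ≤ _ := measureReal_union_le _ _
    _ ≤ 0 + ∑ k ∈ Finset.range n, P.real {ω | ¬ IsQuasirandom δ q (ψ k ω).between} :=
      add_le_add hzero.le (measureReal_biUnion_finset_le _ _)
    _ ≤ n * η := by
      rw [zero_add]
      refine (Finset.sum_le_card_nsmul _ _ η fun k _ => hquasi k).trans_eq ?_
      rw [Finset.card_range, nsmul_eq_mul]

/-- The good event need not be measurable, so the complement of a measurable hull of the bad event
is used. -/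
lemma exists_measurableSet_of_measureReal_compl_le {Ω : Type*} [MeasurableSpace Ω] {P : Measure Ω}
    [IsProbabilityMeasure P] {G : Ω → Prop} {ε : ℝ} (h : P.real {ω | ¬ G ω} ≤ ε) :
    ∃ A : Set Ω, MeasurableSet A ∧ ENNReal.ofReal (1 - ε) ≤ P A ∧ ∀ ω ∈ A, G ω := by
  refine ⟨(toMeasurable P {ω | ¬ G ω})ᶜ, (measurableSet_toMeasurable _ _).compl, ?_, ?_⟩
  · refine ENNReal.ofReal_le_of_le_toReal ?_
    rw [← measureReal_def, probReal_compl_eq_one_sub (measurableSet_toMeasurable _ _),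
      measureReal_def, measure_toMeasurable, ← measureReal_def]
    linarith
  · intro ω hω
    by_contra hG
    exact hω (subset_toMeasurable P _ hG)

theorem theorem2 (p q : unitInterval) (hp₀ : 0 < p) (hp₁ : p < 1) (hq₀ : 0 < q) (hq₁ : q < 1)
    (τ κ Λ : ℝ) (hτ : 0 < τ) (hκ : 0 < κ) (hΛ : 0 < Λ) :
    ∃ T : ℝ, 0 < T ∧ ∀ ε : ℝ, 0 < ε → ∃ N₀ : ℕ, ∀ N₁ N₂ : ℕ, N₀ ≤ min N₁ N₂ →
      1 / κ * (N₁ : ℝ) ≤ (N₂ : ℝ) → (N₂ : ℝ) ≤ κ * (N₁ : ℝ) →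
      ∀ (d : ℕ) (Ω : Type*) [MeasurableSpace Ω] (P : Measure Ω) [IsProbabilityMeasure P]
        (ψ : ℕ → Ω → Coefficients N₁ N₂), IsResampledBernoulli P p q ψ →
        ∃ A : Set Ω, MeasurableSet A ∧ ENNReal.ofReal (1 - ε) ≤ P A ∧
          ∀ ω ∈ A, ∀ (x : ℝ → Fin N₁ → Opinion d) (y : ℝ → Fin N₂ → Opinion d),
            IsSolution (piecewiseConstant τ (fun k => ψ k ω)) x y →
            meanLocation (x 0) ≠ meanLocation (y 0) →
            deviationRatio (x 0) (y 0) ≤ Λ →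
            ∃ v : Opinion d, ‖v‖ = 1 ∧ ∀ t : ℝ, T ≤ t → IsSeparatedBy v (x t) (y t) := by
  have hq : (0 : ℝ) < q := hq₀
  obtain ⟨T, hT, hTL⟩ := exists_affine_lt_exp_mul (Real.sqrt_nonneg Λ) hq
  refine ⟨T, hT, fun ε hε => ?_⟩
  obtain ⟨M, hM⟩ : ∃ M, M = 2 * ((1 + √Λ) * Real.exp (4 * T)) := ⟨_, rfl⟩
  have hM0 : 0 < M := by rw [hM]; positivity
  -- One value meeting all three smallness conditions on `δ`, since `(1 + M) ^ 2 * (1 + T)`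
  -- dominates `M ^ 2 * T`, `M * T` and `M`.
  obtain ⟨δ, hδ⟩ : ∃ δ, δ = 1 / (13 * ((1 + M) ^ 2 * (1 + T))) := ⟨_, rfl⟩
  have hδ0 : 0 < δ := by rw [hδ]; positivity
  have hδ' : δ * (13 * ((1 + M) ^ 2 * (1 + T))) = 1 := by
    rw [hδ]; exact one_div_mul_cancel (by positivity)
  have hδM : 0 < δ * M := by positivity
  have hδT : 0 < δ * T := by positivity
  have hδMT : 0 < δ * M * T := by positivity
  have hδMM : 0 < δ * M ^ 2 := by positivity
  have hδMMT : 0 < δ * M ^ 2 * T := by positivity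
  -- Enough intervals of length `τ` to cover `[0, T)`; each may fail with probability `ε / n`.
  obtain ⟨n, hn⟩ : ∃ n, n = ⌊T / τ⌋₊ + 1 := ⟨_, rfl⟩
  have hn0 : (0 : ℝ) < n := by rw [hn]; positivity
  obtain ⟨N₀, hN₀, hbound⟩ := exists_forall_quasirandom_bound_le hδ0 hκ (div_pos hε hn0)
  refine ⟨N₀, fun N₁ N₂ hN h12 h21 d Ω _ P _ ψ hψ => ?_⟩
  obtain ⟨hN1, hN2⟩ := le_min_iff.1 hN
  have : Nonempty (Fin N₁) := Fin.pos_iff_nonempty.1 (hN₀.trans_le hN1)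
  have : Nonempty (Fin N₂) := Fin.pos_iff_nonempty.1 (hN₀.trans_le hN2)
  have h12' : (N₁ : ℝ) ≤ κ * N₂ := by
    rwa [one_div, inv_mul_le_iff₀ hκ] at h12
  have hbad := hψ.measureReal_bad_le hδ0.le (hbound N₁ N₂ hN1 hN2 h12' h21) n
  rw [mul_div_cancel₀ _ hn0.ne'] at hbad
  obtain ⟨A, hA, hPA, hgood⟩ := exists_measurableSet_of_measureReal_compl_le hbad
  refine ⟨A, hA, hPA, fun ω hω x y hxy hne hratio => ?_⟩
  obtain ⟨hadm, hquasi⟩ := hgood ω hω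
  refine hxy.exists_isSeparatedBy (fun t => hadm _) hne hΛ.le hratio hT hq.le hδ0.le hM
    (fun t ht => hquasi _ ?_) (by linarith) (by linarith) (by linarith) hTL
  rw [hn, Nat.lt_succ_iff]
  exact Nat.floor_mono (div_le_div_of_nonneg_right ht.2.le hτ.le)
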